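/- Let $\mathscr H$ be a complex Hilbert space. For $p>0$ let $\mathbb B_p(\mathscr H)$ be the set of compact operators $T$ on $\mathscr H$ whose singular values $s_j(T)$ (the eigenvalues of $|T|=(T^*T)^{1/2}$, counted with multiplicity) satisfy $\|T\|_p:=\big(\sum_j s_j(T)^p\big)^{1/p}<\infty$. Call a matrix $U\in\mathbb C^{s\times t}$ subunitary if $U^*U=I_t$. For tuples $X=(X_1,\dots,X_s)$ and $Y=(Y_1,\dots,Y_t)$ in $\mathbb B_p(\mathscr H)$ and a matrix $A=(a_{ij})\in\mathbb C^{s\times t}$ consider the Clarkson–McCarthy type inequalities $(\mathrm{PP}_p)$ for $p\ge 2$, \[ s^{1-\frac p2}\sum_{j=1}^t\|Y_j\|_p^p\le\sum_{i=1}^s\|X_i\|_p^p\le t^{\frac p2-1}\sum_{j=1}^t\|Y_j\|_p^p, \] with both inequalities reversed for $0<p\le 2$; $(\mathrm{PQ}_p)$ for $1<p\le 2$ and $q=p/(p-1)$, \[ \sum_{i=1}^s\|X_i\|_p^q\le\Big(\max_{i,j}|a_{ij}|\Big)^{\frac qp-1}\Big(\sum_{j=1}^t\|Y_j\|_p^p\Big)^{\frac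 qp}, \] with the inequality reversed for $p\ge 2$. Let $A\in\mathbb C^{s\times t}$. (1) If $A$ is subunitary, $p>0$, and $X_1,\dots,X_s,Y_1,\dots,Y_t\in\mathbb B_p(\mathscr H)$ satisfy $(X_1,\dots,X_s)^T=A(Y_1,\dots,Y_t)^T$, then $\sum_i|X_i|^2=\sum_j|Y_j|^2$, and $(\mathrm{PP}_p)$ and $(\mathrm{PQ}_p)$ hold (the latter being asserted for $p>1$ only). (2) If $p>0$ and $X_1,\dots,X_s,Y_1,\dots,Y_t\in\mathbb B_p(\mathscr H)$ are any operators with $\sum_i|X_i|^2=\sum_j|Y_j|^2$, then $(\mathrm{PP}_p)$ holds. (3) Suppose that there exist $t$ linearly independent bounded operators on $\mathscr H$, and let $p_0>0$. Then the following are equivalent: (a) $A$ is subunitary; (b) for all tuples $X,Y$ in $\mathbb B_{p_0}(\mathscr H)$ with $Y_1,\dots,Y_t$ linearly independent and $X^T=AY^T$, there is a subunitary $U\in\mathbb C^{s\times t}$ with $X^T=UY^T$; (c) for all tuples $X,Y$ in $\mathbb B_{p_0}(\mathscr H)$ with $Y_1,\dots,Y_t$ linearly independent and $X^T=AY^T$,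 $\sum_i|X_i|^2=\sum_j|Y_j|^2$; (d) for all $p>0$ and all tuples $X,Y$ in $\mathbb B_p(\mathscr H)$ with $Y_1,\dots,Y_t$ linearly independent and $X^T=AY^T$, $(\mathrm{PP}_p)$ and $(\mathrm{PQ}_p)$ hold (the latter for $p>1$); (e) the same as (d) with $(\mathrm{PP}_p)$ alone; (f) the same as (d) with $(\mathrm{PQ}_p)$ alone, for all $p>1$. -/

import Mathlib

open scoped ENNReal Matrix

noncomputable section

section Schatten

variable {H : Type*} [NormedAddCommGroup H] [InnerProductSpace ℂ H] [CompleteSpace H]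

/-- `∑ⱼ sⱼ(T) ^ p` for a compact operator `T`. The nonzero singular values of `T` are the positive
eigenvalues `r` of `|T| = (T* T)^{1/2}`, each repeated according to the (finite) dimension of its
eigenspace. -/
def schattenSum (p : ℝ) (T : H →L[ℂ] H) : ℝ≥0∞ :=
  ∑' r : {r : ℝ // 0 < r},
    (Module.finrank ℂ (Module.End.eigenspace (CFC.abs T : H →L[ℂ] H).toLinearMap ((r : ℝ) : ℂ)) :
      ℝ≥0∞) * ENNReal.ofReal ((r : ℝ) ^ p)

/-- The Schatten class `B_p(H)`: compact operators `T` with `∑ⱼ sⱼ(T) ^ p < ∞`. -/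
def MemSchatten (p : ℝ) (T : H →L[ℂ] H) : Prop :=
  IsCompactOperator T ∧ schattenSum p T ≠ ∞

/-- `‖T‖_p = (∑ⱼ sⱼ(T) ^ p) ^ (1 / p)`. -/
def schattenNorm (p : ℝ) (T : H →L[ℂ] H) : ℝ :=
  (schattenSum p T).toReal ^ (1 / p)

/-- The tuple `U (Y₁, …, Y_t)ᵀ`. -/
def matrixAct {s t : ℕ} (U : Matrix (Fin s) (Fin t) ℂ) (Y : Fin t → H →L[ℂ] H) :
    Fin s → H →L[ℂ] H :=
  fun i => ∑ j, U i j • Y j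

/-- The identity `∑ᵢ |Xᵢ|² = ∑ⱼ |Yⱼ|²`. -/
def SumSquaresEq {s t : ℕ} (X : Fin s → H →L[ℂ] H) (Y : Fin t → H →L[ℂ] H) : Prop :=
  ∑ i, CFC.abs (X i) ^ 2 = ∑ j, CFC.abs (Y j) ^ 2

/-- The two-sided Clarkson–McCarthy inequality between `∑ᵢ ‖Xᵢ‖_p^p` and `∑ⱼ ‖Yⱼ‖_p^p`:
for `p ≥ 2`, and reversed for `p ≤ 2`. -/
def ClarksonMcCarthyPP {s t : ℕ} (p : ℝ) (X : Fin s → H →L[ℂ] H) (Y : Fin t → H →L[ℂ] H) : Prop :=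
  (2 ≤ p →
    (s : ℝ) ^ (1 - p / 2) * ∑ j, schattenNorm p (Y j) ^ p ≤ ∑ i, schattenNorm p (X i) ^ p ∧
    ∑ i, schattenNorm p (X i) ^ p ≤ (t : ℝ) ^ (p / 2 - 1) * ∑ j, schattenNorm p (Y j) ^ p) ∧
  (p ≤ 2 →
    (t : ℝ) ^ (p / 2 - 1) * ∑ j, schattenNorm p (Y j) ^ p ≤ ∑ i, schattenNorm p (X i) ^ p ∧
    ∑ i, schattenNorm p (X i) ^ p ≤ (s : ℝ) ^ (1 - p / 2) * ∑ j, schattenNorm p (Y j) ^ p)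

/-- The Clarkson–McCarthy inequality with the conjugate exponent `q = p / (p - 1)` and the constant
`(maxᵢⱼ |uᵢⱼ|) ^ (q / p - 1)`: for `1 < p ≤ 2`, and reversed for `p ≥ 2`. -/
def ClarksonMcCarthyPQ {s t : ℕ} (p : ℝ) (U : Matrix (Fin s) (Fin t) ℂ)
    (X : Fin s → H →L[ℂ] H) (Y : Fin t → H →L[ℂ] H) : Prop :=
  (1 < p → p ≤ 2 →
    ∑ i, schattenNorm p (X i) ^ p.conjExponent ≤
      (⨆ ij : Fin s × Fin t, ‖U ij.1 ij.2‖) ^ (p.conjExponent / p - 1) *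
        (∑ j, schattenNorm p (Y j) ^ p) ^ (p.conjExponent / p)) ∧
  (2 ≤ p →
    (⨆ ij : Fin s × Fin t, ‖U ij.1 ij.2‖) ^ (p.conjExponent / p - 1) *
        (∑ j, schattenNorm p (Y j) ^ p) ^ (p.conjExponent / p) ≤
      ∑ i, schattenNorm p (X i) ^ p.conjExponent)

/-- `X` and `Y` are tuples in `B_p(H)` with `(X₁, …, X_s)ᵀ = A (Y₁, …, Y_t)ᵀ`. -/
def SchattenRelated {s t : ℕ} (p : ℝ) (A : Matrix (Fin s) (Fin t) ℂ)
    (X : Fin s → H →L[ℂ] H) (Y : Fin t → H →L[ℂ] H) : Prop :=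
  (∀ i, MemSchatten p (X i)) ∧ (∀ j, MemSchatten p (Y j)) ∧ X = matrixAct A Y

end Schatten

/-- A subunitary matrix: its columns are orthonormal, `U* U = I`. -/
def IsSubunitary {s t : ℕ} (U : Matrix (Fin s) (Fin t) ℂ) : Prop :=
  Uᴴ * U = 1

end

/-!
The inequalities `(PP_p)` only see `∑ᵢ Xᵢ* Xᵢ`, which is `C* C` for the column `C = (X₁, …, X_s)ᵀ`.
In the singular bases of `C` and of the `Xᵢ`, Jensen's inequality for `x ↦ x ^ (p / 2)` compares
`∑ᵢ ‖Xᵢ‖_p^p` with the sum of the `p`-th powers of the singular values of `C`, and the latter is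
the same for `X` and `Y`.

For `(PQ_p)`, `Y ↦ A Y` becomes a scalar matrix in the singular bases of `X` and `Y`. As a bilinear
form, with blocks given by the members of the tuples, it is bounded by `max |aᵢⱼ|` for the norms of
`ℓ¹(ℓ^∞)` and by `1` for those of `ℓ²`, because `A` is subunitary; Stein interpolation gives the
bound for `ℓ^p(ℓ^q)` when `p ≤ 2`. For `p ≥ 2` one uses the transposed form and duality.

Conversely, at `p = 2` each condition says that `Y ↦ A Y` preserves the Hilbert–Schmidt norm on an
open set of tuples of finite rank operators; by the parallelogram law it does so everywhere, and
then `A` is subunitary.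
-/

open scoped InnerProductSpace
open ContinuousLinearMap (adjoint)

/-! ### Jensen's inequality for extended nonnegative sums -/

section Jensen

variable {κ : Type*}

theorem rpow_tsum_mul_le_tsum_rpow_mul {r : ℝ} (hr : 1 ≤ r) (a c : κ → ℝ≥0∞)
    (hc : ∑' k, c k ≤ 1) : (∑' k, a k * c k) ^ r ≤ ∑' k, a k ^ r * c k := by
  have hr0 : 0 < r := one_pos.trans_le hr
  rw [← ENNReal.le_rpow_inv_iff hr0, ENNReal.tsum_eq_iSup_sum]
  refine iSup_le fun F => ?_
  rw [ENNReal.le_rpow_inv_iff hr0]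
  refine le_trans ?_ (ENNReal.sum_le_tsum F)
  have hF : ∑ k ∈ F, c k ≤ 1 := (ENNReal.sum_le_tsum F).trans hc
  -- The missing mass `1 - ∑ k ∈ F, c k` is placed at an additional point, where `a` vanishes.
  have jensen := ENNReal.rpow_arith_mean_le_arith_mean_rpow (Finset.insertNone F)
    (fun o => o.elim (1 - ∑ k ∈ F, c k) c) (fun o => o.elim 0 a)
    (by simpa only [Finset.sum_insertNone, Option.elim] using tsub_add_cancel_of_le hF) hr
  simpa [Finset.sum_insertNone, ENNReal.zero_rpow_of_pos hr0, mul_comm] using jensen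

theorem tsum_rpow_mul_le_rpow_tsum_mul {r : ℝ} (hr0 : 0 < r) (hr : r ≤ 1) (a c : κ → ℝ≥0∞)
    (hc : ∑' k, c k ≤ 1) : ∑' k, a k ^ r * c k ≤ (∑' k, a k * c k) ^ r := by
  have h := rpow_tsum_mul_le_tsum_rpow_mul ((one_le_inv₀ hr0).2 hr) (fun k => a k ^ r) c hc
  rw [ENNReal.rpow_inv_le_iff hr0] at h
  simpa [← ENNReal.rpow_mul, hr0.ne'] using h

theorem sum_rpow_le_card_rpow_mul_rpow_sum (s : Finset κ) (f : κ → ℝ≥0∞) {r : ℝ}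
    (hr0 : 0 < r) (hr : r ≤ 1) :
    ∑ i ∈ s, f i ^ r ≤ (s.card : ℝ≥0∞) ^ (1 - r) * (∑ i ∈ s, f i) ^ r := by
  have h := ENNReal.rpow_sum_le_const_mul_sum_rpow s (fun i => f i ^ r) ((one_le_inv₀ hr0).2 hr)
  rw [ENNReal.rpow_inv_le_iff hr0, ENNReal.mul_rpow_of_nonneg _ _ hr0.le, ← ENNReal.rpow_mul] at h
  have hexp : (r⁻¹ - 1) * r = 1 - r := by field_simp
  simpa [← ENNReal.rpow_mul, hr0.ne', hexp] using h

theorem sq_rpow_half (x : ℝ≥0∞) (p : ℝ) : (x ^ 2) ^ (p / 2) = x ^ p := by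
  rw [← ENNReal.rpow_natCast, ← ENNReal.rpow_mul, Nat.cast_ofNat, mul_div_cancel₀ p two_ne_zero]

end Jensen

/-! ### Orthonormal expansions -/

section OrthonormalExpansion

variable {E : Type*} [NormedAddCommGroup E] [InnerProductSpace ℂ E] {κ : Type*} {v : κ → E}
  {c : κ → ℂ} {y : E}

theorem inner_self_eq_ofReal_norm_sq (x : E) : ⟪x, x⟫_ℂ = ((‖x‖ ^ 2 : ℝ) : ℂ) := by
  rw [inner_self_eq_norm_sq_to_K, Complex.ofReal_pow]
  rfl

theorem inner_eq_of_hasSum_orthonormal (hv : Orthonormal ℂ v)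
    (h : HasSum (fun k => c k • v k) y) (k : κ) : ⟪v k, y⟫_ℂ = c k := by
  have hterms : HasSum (fun l => ⟪v k, c l • v l⟫_ℂ) ⟪v k, y⟫_ℂ := h.mapL (innerSL ℂ (v k))
  have hsingle : HasSum (fun l => ⟪v k, c l • v l⟫_ℂ) ⟪v k, c k • v k⟫_ℂ :=
    hasSum_single k fun l hl => by rw [inner_smul_right, hv.2 hl.symm, mul_zero]
  rw [hterms.unique hsingle, inner_smul_right, inner_self_eq_one_of_norm_eq_one (hv.1 k), mul_one]

theorem hasSum_norm_sq_of_hasSum_orthonormal (hv : Orthonormal ℂ v)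
    (h : HasSum (fun k => c k • v k) y) : HasSum (fun k => ‖c k‖ ^ 2) (‖y‖ ^ 2) := by
  have hinner : HasSum (fun k => ⟪y, c k • v k⟫_ℂ) ⟪y, y⟫_ℂ := h.mapL (innerSL ℂ y)
  have hterm (k : κ) : ⟪y, c k • v k⟫_ℂ = ((‖c k‖ ^ 2 : ℝ) : ℂ) := by
    rw [inner_smul_right, ← inner_conj_symm, inner_eq_of_hasSum_orthonormal hv h k,
      Complex.mul_conj, Complex.normSq_eq_norm_sq]
  simp only [hterm, inner_self_eq_ofReal_norm_sq] at hinner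
  exact Complex.hasSum_ofReal.1 hinner

theorem enorm_sq_eq_ofReal_norm_sq {G : Type*} [SeminormedAddGroup G] (x : G) :
    ‖x‖ₑ ^ 2 = ENNReal.ofReal (‖x‖ ^ 2) := by
  rw [ENNReal.ofReal_pow (norm_nonneg x), ofReal_norm]

theorem enorm_sq_eq_one {G : Type*} [SeminormedAddGroup G] {x : G} (hx : ‖x‖ = 1) :
    ‖x‖ₑ ^ 2 = 1 := by
  rw [enorm_sq_eq_ofReal_norm_sq, hx, one_pow, ENNReal.ofReal_one]

theorem tsum_enorm_sq_of_hasSum_orthonormal (hv : Orthonormal ℂ v)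
    (h : HasSum (fun k => c k • v k) y) : ∑' k, ‖c k‖ₑ ^ 2 = ‖y‖ₑ ^ 2 := by
  have hsq := hasSum_norm_sq_of_hasSum_orthonormal hv h
  simp only [enorm_sq_eq_ofReal_norm_sq]
  rw [← hsq.tsum_eq, ENNReal.ofReal_tsum_of_nonneg (fun _ => sq_nonneg _) hsq.summable]

theorem tsum_enorm_inner_sq_le (hv : Orthonormal ℂ v) (x : E) :
    ∑' k, ‖⟪v k, x⟫_ℂ‖ₑ ^ 2 ≤ ‖x‖ₑ ^ 2 := by
  simp only [enorm_sq_eq_ofReal_norm_sq]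
  rw [← ENNReal.ofReal_tsum_of_nonneg (fun _ => sq_nonneg _) (hv.inner_products_summable x)]
  exact ENNReal.ofReal_le_ofReal (hv.tsum_inner_products_le x)

theorem tsum_enorm_inner_sq_le_one (hv : Orthonormal ℂ v) {x : E} (hx : ‖x‖ = 1) :
    ∑' k, ‖⟪v k, x⟫_ℂ‖ₑ ^ 2 ≤ 1 :=
  (tsum_enorm_inner_sq_le hv x).trans (enorm_sq_eq_one hx).le

theorem summable_inner_smul_orthonormal [CompleteSpace E] (hv : Orthonormal ℂ v) (x : E) :
    Summable fun k => ⟪v k, x⟫_ℂ • v k := by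
  have h := hv.orthogonalFamily.summable_iff_norm_sq_summable (fun k => ⟪v k, x⟫_ℂ)
  simp only [LinearIsometry.toSpanSingleton_apply] at h
  exact h.2 (hv.inner_products_summable x)

theorem enorm_inner_symm (x y : E) : ‖⟪x, y⟫_ℂ‖ₑ = ‖⟪y, x⟫_ℂ‖ₑ := by
  rw [← ofReal_norm, ← ofReal_norm, norm_inner_symm]

end OrthonormalExpansion

/-! ### Singular value decompositions -/

section SingularSystem

variable {E F : Type*} [NormedAddCommGroup E] [InnerProductSpace ℂ E] [CompleteSpace E]
  [NormedAddCommGroup F] [InnerProductSpace ℂ F] [CompleteSpace F] {κ : Type*}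

/-- A singular value decomposition `T = ∑ₖ sₖ ⟪eₖ, ·⟫ fₖ` with positive singular values `sₖ`. -/
structure IsSingularSystem (T : E →L[ℂ] F) (e : κ → E) (f : κ → F) (s : κ → ℝ) : Prop where
  orthonormal_left : Orthonormal ℂ e
  orthonormal_right : Orthonormal ℂ f
  pos : ∀ k, 0 < s k
  apply_left : ∀ k, T (e k) = (s k : ℂ) • f k
  adjoint_apply_right : ∀ k, adjoint T (f k) = (s k : ℂ) • e k
  apply_eq_zero : ∀ x, (∀ k, ⟪e k, x⟫_ℂ = 0) → T x = 0

namespace IsSingularSystem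

variable {T : E →L[ℂ] F} {e : κ → E} {f : κ → F} {s : κ → ℝ}

theorem hasSum_apply (h : IsSingularSystem T e f s) (x : E) :
    HasSum (fun k => ((s k : ℂ) * ⟪e k, x⟫_ℂ) • f k) (T x) := by
  have hproj := (summable_inner_smul_orthonormal h.orthonormal_left x).hasSum
  set y := ∑' k, ⟪e k, x⟫_ℂ • e k
  have hTxy : T x = T y := by
    rw [← sub_eq_zero, ← map_sub]
    refine h.apply_eq_zero _ fun k => ?_
    rw [inner_sub_right, inner_eq_of_hasSum_orthonormal h.orthonormal_left hproj k, sub_self]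
  rw [hTxy]
  convert hproj.mapL T using 2 with k
  rw [map_smul, h.apply_left, smul_smul, mul_comm]

protected theorem adjoint (h : IsSingularSystem T e f s) :
    IsSingularSystem (adjoint T) f e s where
  orthonormal_left := h.orthonormal_right
  orthonormal_right := h.orthonormal_left
  pos := h.pos
  apply_left := h.adjoint_apply_right
  adjoint_apply_right := by simpa only [ContinuousLinearMap.adjoint_adjoint] using h.apply_left
  apply_eq_zero y hy := by
    refine ext_inner_right ℂ fun x => ?_
    rw [ContinuousLinearMap.adjoint_inner_left, inner_zero_left]
    have hsum : HasSum (fun k => ⟪y, ((s k : ℂ) * ⟪e k, x⟫_ℂ) • f k⟫_ℂ) ⟪y, T x⟫_ℂ :=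
      (h.hasSum_apply x).mapL (innerSL ℂ y)
    refine hsum.unique ?_
    convert hasSum_zero with k
    rw [inner_smul_right, inner_eq_zero_symm.1 (hy k), mul_zero]

theorem enorm_apply_sq (h : IsSingularSystem T e f s) (x : E) :
    ‖T x‖ₑ ^ 2 = ∑' k, ENNReal.ofReal (s k) ^ 2 * ‖⟪e k, x⟫_ℂ‖ₑ ^ 2 := by
  rw [← tsum_enorm_sq_of_hasSum_orthonormal h.orthonormal_right (h.hasSum_apply x)]
  refine tsum_congr fun k => ?_
  rw [enorm_mul, mul_pow, ← ofReal_norm, Complex.norm_of_nonneg (h.pos k).le]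

theorem enorm_apply_left (h : IsSingularSystem T e f s) (k : κ) :
    ‖T (e k)‖ₑ = ENNReal.ofReal (s k) := by
  rw [h.apply_left, ← ofReal_norm, norm_smul, h.orthonormal_right.1,
    Complex.norm_of_nonneg (h.pos k).le, mul_one]

theorem enorm_apply_rpow_le (h : IsSingularSystem T e f s) {x : E} (hx : ‖x‖ = 1) {p : ℝ}
    (hp : 2 ≤ p) : ‖T x‖ₑ ^ p ≤ ∑' k, ENNReal.ofReal (s k) ^ p * ‖⟪e k, x⟫_ℂ‖ₑ ^ 2 := by
  rw [← sq_rpow_half, h.enorm_apply_sq]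
  simp only [← sq_rpow_half (ENNReal.ofReal _) p]
  exact rpow_tsum_mul_le_tsum_rpow_mul (by linarith) _ _
    (tsum_enorm_inner_sq_le_one h.orthonormal_left hx)

theorem le_enorm_apply_rpow (h : IsSingularSystem T e f s) {x : E} (hx : ‖x‖ = 1) {p : ℝ}
    (hp0 : 0 < p) (hp : p ≤ 2) :
    ∑' k, ENNReal.ofReal (s k) ^ p * ‖⟪e k, x⟫_ℂ‖ₑ ^ 2 ≤ ‖T x‖ₑ ^ p := by
  rw [← sq_rpow_half, h.enorm_apply_sq]
  simp only [← sq_rpow_half (ENNReal.ofReal _) p]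
  exact tsum_rpow_mul_le_rpow_tsum_mul (by linarith) (by linarith) _ _
    (tsum_enorm_inner_sq_le_one h.orthonormal_left hx)

theorem tsum_enorm_apply_rpow_le (h : IsSingularSystem T e f s) {ι : Type*} {v : ι → E}
    (hv : Orthonormal ℂ v) {p : ℝ} (hp : 2 ≤ p) :
    ∑' m, ‖T (v m)‖ₑ ^ p ≤ ∑' k, ENNReal.ofReal (s k) ^ p := by
  calc ∑' m, ‖T (v m)‖ₑ ^ p
      ≤ ∑' m, ∑' k, ENNReal.ofReal (s k) ^ p * ‖⟪e k, v m⟫_ℂ‖ₑ ^ 2 :=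
        ENNReal.tsum_le_tsum fun m => h.enorm_apply_rpow_le (hv.1 m) hp
    _ = ∑' k, ENNReal.ofReal (s k) ^ p * ∑' m, ‖⟪v m, e k⟫_ℂ‖ₑ ^ 2 := by
        rw [ENNReal.tsum_comm]
        simp only [ENNReal.tsum_mul_left, enorm_inner_symm (e _)]
    _ ≤ ∑' k, ENNReal.ofReal (s k) ^ p :=
        ENNReal.tsum_le_tsum fun k =>
          mul_le_of_le_one_right' (tsum_enorm_inner_sq_le_one hv (h.orthonormal_left.1 k))

theorem le_tsum_enorm_apply_rpow (h : IsSingularSystem T e f s) {ι : Type*} {v : ι → E}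
    (hv : ∀ m, ‖v m‖ = 1) (hev : ∀ k, 1 ≤ ∑' m, ‖⟪v m, e k⟫_ℂ‖ₑ ^ 2)
    {p : ℝ} (hp0 : 0 < p) (hp : p ≤ 2) :
    ∑' k, ENNReal.ofReal (s k) ^ p ≤ ∑' m, ‖T (v m)‖ₑ ^ p := by
  calc ∑' k, ENNReal.ofReal (s k) ^ p
      ≤ ∑' k, ENNReal.ofReal (s k) ^ p * ∑' m, ‖⟪v m, e k⟫_ℂ‖ₑ ^ 2 :=
        ENNReal.tsum_le_tsum fun k => le_mul_of_one_le_right' (hev k)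
    _ = ∑' m, ∑' k, ENNReal.ofReal (s k) ^ p * ‖⟪e k, v m⟫_ℂ‖ₑ ^ 2 := by
        rw [ENNReal.tsum_comm]
        simp only [ENNReal.tsum_mul_left, enorm_inner_symm (e _)]
    _ ≤ ∑' m, ‖T (v m)‖ₑ ^ p :=
        ENNReal.tsum_le_tsum fun m => h.le_enorm_apply_rpow (hv m) hp0 hp

theorem of_eigenvectors (he : Orthonormal ℂ e) (hs : ∀ k, 0 < s k)
    (heig : ∀ k, (adjoint T ∘L T) (e k) = ((s k ^ 2 : ℝ) : ℂ) • e k)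
    (hzero : ∀ x, (∀ k, ⟪e k, x⟫_ℂ = 0) → T x = 0) :
    IsSingularSystem T e (fun k => (s k : ℂ)⁻¹ • T (e k)) s := by
  have hne (k : κ) : (s k : ℂ) ≠ 0 := Complex.ofReal_ne_zero.2 (hs k).ne'
  have hinner (k l : κ) : ⟪T (e k), T (e l)⟫_ℂ = (s l : ℂ) ^ 2 * ⟪e k, e l⟫_ℂ := by
    rw [← ContinuousLinearMap.adjoint_inner_right, ← ContinuousLinearMap.comp_apply, heig,
      inner_smul_right, Complex.ofReal_pow]
  refine ⟨he, ⟨fun k => ?_, fun k l hkl => ?_⟩, hs, fun k => ?_, fun k => ?_, hzero⟩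
  · have hnorm : ‖T (e k)‖ ^ 2 = s k ^ 2 := by
      have h := hinner k k
      rw [inner_self_eq_ofReal_norm_sq, inner_self_eq_one_of_norm_eq_one (he.1 k), mul_one] at h
      exact_mod_cast h
    rw [norm_smul, norm_inv, Complex.norm_of_nonneg (hs k).le,
      (pow_left_inj₀ (norm_nonneg _) (hs k).le two_ne_zero).1 hnorm, inv_mul_cancel₀ (hs k).ne']
  · change ⟪(s k : ℂ)⁻¹ • T (e k), (s l : ℂ)⁻¹ • T (e l)⟫_ℂ = 0
    rw [inner_smul_left, inner_smul_right, hinner, he.2 hkl, mul_zero, mul_zero, mul_zero]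
  · rw [smul_inv_smul₀ (hne k)]
  · rw [map_smul, ← ContinuousLinearMap.comp_apply, heig, smul_smul, Complex.ofReal_pow, sq,
      inv_mul_cancel_left₀ (hne k)]

end IsSingularSystem

theorem apply_eq_zero_of_orthogonal_eigenspaces {K : E →L[ℂ] E} (hK : IsCompactOperator K)
    (hsymm : (K : E →ₗ[ℂ] E).IsSymmetric) {x : E}
    (hx : ∀ μ : ℂ, μ ≠ 0 → ∀ y ∈ Module.End.eigenspace (K : E →ₗ[ℂ] E) μ, ⟪y, x⟫_ℂ = 0) :
    K x = 0 := by
  suffices K x ∈ (⨆ μ, Module.End.eigenspace (K : E →ₗ[ℂ] E) μ)ᗮ by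
    rwa [ContinuousLinearMap.orthogonalComplement_iSup_eigenspaces_eq_bot hK hsymm,
      Submodule.mem_bot] at this
  rw [← Submodule.iInf_orthogonal, Submodule.mem_iInf]
  refine fun μ => (Submodule.mem_orthogonal _ _).2 fun y hy => ?_
  have hswap : ⟪y, K x⟫_ℂ = (starRingEnd ℂ) μ * ⟪y, x⟫_ℂ := by
    rw [← inner_smul_left, ← Module.End.mem_eigenspace_iff.1 hy]
    exact (hsymm y x).symm
  rcases eq_or_ne μ 0 with rfl | hμ
  · rw [hswap, map_zero, zero_mul]
  · rw [hswap, hx μ hμ y hy, mul_zero]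

theorem isSymmetric_adjoint_comp_self (T : E →L[ℂ] F) :
    ((adjoint T ∘L T : E →L[ℂ] E) : E →ₗ[ℂ] E).IsSymmetric :=
  (ContinuousLinearMap.isPositive_adjoint_comp_self T).isSymmetric

theorem exists_sq_eq_of_mem_eigenspace_adjoint_comp_self {T : E →L[ℂ] F} {μ : ℂ} (hμ : μ ≠ 0)
    {y : E} (hy : y ∈ Module.End.eigenspace (adjoint T ∘L T).toLinearMap μ) (hy0 : y ≠ 0) :
    ∃ r : ℝ, 0 < r ∧ μ = ((r ^ 2 : ℝ) : ℂ) := by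
  have hyn : ((‖y‖ ^ 2 : ℝ) : ℂ) ≠ 0 :=
    Complex.ofReal_ne_zero.2 (pow_ne_zero 2 (norm_ne_zero_iff.2 hy0))
  have hTy : ((‖T y‖ ^ 2 : ℝ) : ℂ) = μ * ((‖y‖ ^ 2 : ℝ) : ℂ) := by
    have hadj := ContinuousLinearMap.adjoint_inner_right T y (T y)
    rw [← ContinuousLinearMap.comp_apply] at hadj
    rw [show (adjoint T ∘L T) y = μ • y from Module.End.mem_eigenspace_iff.1 hy,
      inner_smul_right, inner_self_eq_ofReal_norm_sq, inner_self_eq_ofReal_norm_sq] at hadj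
    exact hadj.symm
  have hμr : μ = (((‖T y‖ / ‖y‖) ^ 2 : ℝ) : ℂ) := by
    rw [div_pow, Complex.ofReal_div, hTy, mul_div_cancel_right₀ _ hyn]
  refine ⟨‖T y‖ / ‖y‖, lt_of_le_of_ne (by positivity) fun h => hμ ?_, hμr⟩
  rw [hμr, ← h, zero_pow two_ne_zero, Complex.ofReal_zero]

/-- The index set of the nonzero singular values, counted with multiplicity, of an operator `T`
with `T* T = K`. -/
abbrev SingularIndex (K : E →L[ℂ] E) : Type :=
  Σ r : {r : ℝ // 0 < r},
    Fin (Module.finrank ℂ (Module.End.eigenspace K.toLinearMap (((r : ℝ) ^ 2 : ℝ) : ℂ)))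

theorem exists_orthonormal_eigenvectors {K : E →L[ℂ] E} (hK : IsCompactOperator K)
    (hsymm : (K : E →ₗ[ℂ] E).IsSymmetric) :
    ∃ e : SingularIndex K → E, Orthonormal ℂ e ∧
      (∀ k, K (e k) = (((k.1 : ℝ) ^ 2 : ℝ) : ℂ) • e k) ∧
      ∀ x, (∀ k, ⟪e k, x⟫_ℂ = 0) → ∀ r : ℝ, 0 < r →
        ∀ y ∈ Module.End.eigenspace K.toLinearMap ((r ^ 2 : ℝ) : ℂ), ⟪y, x⟫_ℂ = 0 := by
  have hfin (r : {r : ℝ // 0 < r}) :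
      FiniteDimensional ℂ (Module.End.eigenspace K.toLinearMap (((r : ℝ) ^ 2 : ℝ) : ℂ)) :=
    ContinuousLinearMap.finite_dimensional_eigenspace hK _
      (Complex.ofReal_ne_zero.2 (pow_pos r.2 2).ne')
  let b (r : {r : ℝ // 0 < r}) := stdOrthonormalBasis ℂ
    (Module.End.eigenspace K.toLinearMap (((r : ℝ) ^ 2 : ℝ) : ℂ))
  have hsq : Function.Injective fun r : {r : ℝ // 0 < r} => (((r : ℝ) ^ 2 : ℝ) : ℂ) :=
    fun r r' h => Subtype.ext
      ((pow_left_inj₀ r.2.le r'.2.le two_ne_zero).1 (Complex.ofReal_injective h))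
  refine ⟨fun k => b k.1 k.2, ?_, fun k => Module.End.mem_eigenspace_iff.1 (b k.1 k.2).2, ?_⟩
  · exact (hsymm.orthogonalFamily_eigenspaces.comp hsq).orthonormal_sigma_orthonormal
      fun r => (b r).orthonormal
  · intro x hx r hr y hy
    have hy_sum := congrArg Subtype.val ((b ⟨r, hr⟩).sum_repr' ⟨y, hy⟩)
    rw [← show _ = y from hy_sum, Submodule.coe_sum, sum_inner]
    exact Finset.sum_eq_zero fun i _ => by
      rw [Submodule.coe_smul, inner_smul_left, hx ⟨⟨r, hr⟩, i⟩, mul_zero]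

theorem exists_isSingularSystem (T : E →L[ℂ] F) (hT : IsCompactOperator (adjoint T ∘L T)) :
    ∃ (e : SingularIndex (adjoint T ∘L T) → E) (f : SingularIndex (adjoint T ∘L T) → F),
      IsSingularSystem T e f fun k => (k.1 : ℝ) := by
  have hsymm := isSymmetric_adjoint_comp_self T
  obtain ⟨e, he, heig, horth⟩ := exists_orthonormal_eigenvectors hT hsymm
  refine ⟨e, _, .of_eigenvectors he (fun k => k.1.2) heig fun x hx => ?_⟩
  have hKx : (adjoint T ∘L T) x = 0 := by
    refine apply_eq_zero_of_orthogonal_eigenspaces hT hsymm fun μ hμ y hy => ?_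
    rcases eq_or_ne y 0 with rfl | hy0
    · exact inner_zero_left x
    obtain ⟨r, hr, rfl⟩ := exists_sq_eq_of_mem_eigenspace_adjoint_comp_self hμ hy hy0
    exact horth x hx r hr y hy
  have hnorm := ContinuousLinearMap.apply_norm_sq_eq_inner_adjoint_left T x
  rw [hKx, inner_zero_left, map_zero] at hnorm
  simpa using hnorm

end SingularSystem

section SchattenSum

variable {H : Type*} [NormedAddCommGroup H] [InnerProductSpace ℂ H]

theorem eigenspace_comp_self_of_isPositive {P : H →L[ℂ] H} (hP : P.IsPositive) {r : ℝ}
    (hr : 0 < r) : Module.End.eigenspace (P ∘L P).toLinearMap ((r ^ 2 : ℝ) : ℂ) =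
      Module.End.eigenspace P.toLinearMap (r : ℂ) := by
  ext x
  simp only [Module.End.mem_eigenspace_iff, ContinuousLinearMap.coe_coe,
    ContinuousLinearMap.comp_apply, Complex.ofReal_pow]
  refine ⟨fun hPP => ?_, fun hP => by rw [hP, map_smul, hP, smul_smul, sq]⟩
  -- `P + r` is injective, and it annihilates `P x - r x`.
  set y := P x - (r : ℂ) • x with hy
  have hPy : P y = -((r : ℂ) • y) := by
    rw [hy, map_sub, hPP, map_smul, smul_sub, smul_smul, sq, neg_sub]
  have hinner : 0 ≤ -(r * ‖y‖ ^ 2) := by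
    have h := hP.re_inner_nonneg_left y
    rw [hPy, inner_neg_left, inner_smul_left, inner_self_eq_ofReal_norm_sq, Complex.conj_ofReal,
      ← Complex.ofReal_mul, ← Complex.ofReal_neg] at h
    exact h
  have hy0 : ‖y‖ ^ 2 = 0 := by nlinarith [mul_nonneg hr.le (sq_nonneg ‖y‖), sq_nonneg ‖y‖]
  exact sub_eq_zero.1 (norm_eq_zero.1 (pow_eq_zero_iff two_ne_zero |>.1 hy0))

variable [CompleteSpace H]

theorem eigenspace_abs (T : H →L[ℂ] H) {r : ℝ} (hr : 0 < r) :
    Module.End.eigenspace (CFC.abs T : H →L[ℂ] H).toLinearMap (r : ℂ) =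
      Module.End.eigenspace (adjoint T ∘L T).toLinearMap ((r ^ 2 : ℝ) : ℂ) := by
  rw [← eigenspace_comp_self_of_isPositive
    ((ContinuousLinearMap.nonneg_iff_isPositive _).1 (CFC.abs_nonneg T)) hr]
  exact congrArg (fun S : H →L[ℂ] H => Module.End.eigenspace S.toLinearMap ((r ^ 2 : ℝ) : ℂ))
    (CFC.abs_mul_abs T)

/-- `∑ₖ σₖ ^ p`, where the `σₖ ^ 2` are the positive eigenvalues of `K`. For `K = ∑ᵢ Xᵢ* Xᵢ` these
`σₖ` are the singular values of the column `(X₁, …, Xₙ)ᵀ`. -/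
noncomputable def eigenvalueSum (p : ℝ) (K : H →L[ℂ] H) : ℝ≥0∞ :=
  ∑' k : SingularIndex K, ENNReal.ofReal (k.1 : ℝ) ^ p

theorem schattenSum_eq_eigenvalueSum (p : ℝ) (T : H →L[ℂ] H) :
    schattenSum p T = eigenvalueSum p (adjoint T ∘L T) := by
  rw [eigenvalueSum, ENNReal.tsum_sigma', schattenSum]
  refine tsum_congr fun r => ?_
  rw [eigenspace_abs T r.2, tsum_fintype, ← ENNReal.ofReal_rpow_of_pos r.2]
  dsimp only
  rw [Finset.sum_const, Finset.card_fin, nsmul_eq_mul]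

theorem exists_isSingularSystem_schattenSum {T : H →L[ℂ] H} (hT : IsCompactOperator T) :
    ∃ (κ : Type) (e f : κ → H) (s : κ → ℝ), IsSingularSystem T e f s ∧
      ∀ p : ℝ, schattenSum p T = ∑' k, ENNReal.ofReal (s k) ^ p := by
  obtain ⟨e, f, h⟩ := exists_isSingularSystem T (hT.clm_comp (adjoint T))
  exact ⟨_, e, f, _, h, fun p => schattenSum_eq_eigenvalueSum p T⟩

theorem schattenNorm_rpow {p : ℝ} (hp : p ≠ 0) (T : H →L[ℂ] H) :
    schattenNorm p T ^ p = (schattenSum p T).toReal := by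
  rw [schattenNorm, one_div, Real.rpow_inv_rpow ENNReal.toReal_nonneg hp]

theorem schattenNorm_nonneg (p : ℝ) (T : H →L[ℂ] H) : 0 ≤ schattenNorm p T :=
  Real.rpow_nonneg ENNReal.toReal_nonneg _

end SchattenSum

/-! ### The column of a tuple and the inequalities `(PP_p)` -/

section Column

variable {E F : Type*} [NormedAddCommGroup E] [InnerProductSpace ℂ E]
  [NormedAddCommGroup F] [InnerProductSpace ℂ F] {ι : Type*}

/-- The column operator `x ↦ (Xᵢ x)ᵢ` of a tuple `X`; it satisfies `C* C = ∑ᵢ Xᵢ* Xᵢ`. -/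
noncomputable def columnOperator (X : ι → E →L[ℂ] F) : E →L[ℂ] PiLp 2 (fun _ : ι => F) :=
  ((PiLp.continuousLinearEquiv 2 ℂ (fun _ : ι => F)).symm :
    (ι → F) →L[ℂ] PiLp 2 (fun _ : ι => F)) ∘L ContinuousLinearMap.pi X

theorem columnOperator_apply (X : ι → E →L[ℂ] F) (x : E) (i : ι) :
    columnOperator X x i = X i x := rfl

variable [Fintype ι]

theorem enorm_columnOperator_sq (X : ι → E →L[ℂ] F) (x : E) :
    ‖columnOperator X x‖ₑ ^ 2 = ∑ i, ‖X i x‖ₑ ^ 2 := by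
  simp only [enorm_sq_eq_ofReal_norm_sq]
  rw [PiLp.norm_sq_eq_of_L2, ENNReal.ofReal_sum_of_nonneg fun _ _ => sq_nonneg _]
  rfl

theorem isCompactOperator_sum {K : ι → E →L[ℂ] F} (h : ∀ i, IsCompactOperator (K i)) :
    IsCompactOperator (∑ i, K i : E →L[ℂ] F) :=
  Submodule.sum_mem (compactOperator (RingHom.id ℂ) E F) fun i _ => h i

theorem inner_piLp_single [DecidableEq ι] (i : ι) (x : F) (y : PiLp 2 (fun _ : ι => F)) :
    ⟪PiLp.single 2 i x, y⟫_ℂ = ⟪x, y i⟫_ℂ := by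
  rw [PiLp.inner_apply, Finset.sum_eq_single i (fun j _ hj => ?_) (by simp)]
  · rw [PiLp.single_apply, if_pos rfl]
  · rw [PiLp.single_apply, if_neg hj, inner_zero_left]

theorem orthonormal_piLp_single [DecidableEq ι] {μ : ι → Type*} {f : ∀ i, μ i → F}
    (hf : ∀ i, Orthonormal ℂ (f i)) :
    Orthonormal ℂ fun a : Σ i, μ i => (PiLp.single 2 a.1 (f a.1 a.2) : PiLp 2 fun _ : ι => F) := by
  classical
  rw [orthonormal_iff_ite]
  rintro ⟨i, k⟩ ⟨j, l⟩
  rw [inner_piLp_single]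
  by_cases hij : i = j
  · subst hij
    simpa using orthonormal_iff_ite.1 (hf i) k l
  · simp [hij]

variable [CompleteSpace E] [CompleteSpace F]

theorem adjoint_columnOperator_single [DecidableEq ι] (X : ι → E →L[ℂ] F) (i : ι) (y : F) :
    adjoint (columnOperator X) (PiLp.single 2 i y) = adjoint (X i) y := by
  refine ext_inner_right ℂ fun x => ?_
  rw [ContinuousLinearMap.adjoint_inner_left, ContinuousLinearMap.adjoint_inner_left,
    inner_piLp_single, columnOperator_apply]

theorem adjoint_columnOperator_comp (X : ι → E →L[ℂ] F) :
    adjoint (columnOperator X) ∘L columnOperator X = ∑ i, adjoint (X i) ∘L X i := by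
  ext x
  refine ext_inner_right ℂ fun y => ?_
  simp only [ContinuousLinearMap.comp_apply, ContinuousLinearMap.adjoint_inner_left,
    PiLp.inner_apply, sum_apply, sum_inner, columnOperator_apply]

end Column

section ColumnBounds

variable {E F : Type*} [NormedAddCommGroup E] [InnerProductSpace ℂ E] [CompleteSpace E]
  [NormedAddCommGroup F] [InnerProductSpace ℂ F] [CompleteSpace F]

namespace IsSingularSystem

variable {κ : Type*} {T : E →L[ℂ] F} {e : κ → E} {f : κ → F} {s : κ → ℝ}

theorem exists_apply_eq_right (h : IsSingularSystem T e f s) (k : κ) : ∃ x, T x = f k :=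
  ⟨(s k : ℂ)⁻¹ • e k, by
    rw [map_smul, h.apply_left, inv_smul_smul₀ (Complex.ofReal_ne_zero.2 (h.pos k).ne')]⟩

theorem tsum_enorm_inner_right_sq (h : IsSingularSystem T e f s) (x : E) :
    ∑' k, ‖⟪f k, T x⟫_ℂ‖ₑ ^ 2 = ‖T x‖ₑ ^ 2 := by
  rw [← tsum_enorm_sq_of_hasSum_orthonormal h.orthonormal_right (h.hasSum_apply x)]
  simp only [inner_eq_of_hasSum_orthonormal h.orthonormal_right (h.hasSum_apply x)]

end IsSingularSystem

variable {ι : Type*} [Fintype ι] {X : ι → E →L[ℂ] F}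
  {κ : Type*} {e : κ → E} {g : κ → PiLp 2 (fun _ : ι => F)} {σ : κ → ℝ}
  {μ : ι → Type*} {u : ∀ i, μ i → E} {f : ∀ i, μ i → F} {s : ∀ i, μ i → ℝ} {p : ℝ}

theorem enorm_adjoint_columnOperator_single [DecidableEq ι]
    (hX : ∀ i, IsSingularSystem (X i) (u i) (f i) (s i)) (i : ι) (m : μ i) :
    ‖adjoint (columnOperator X) (PiLp.single 2 i (f i m))‖ₑ = ENNReal.ofReal (s i m) := by
  rw [adjoint_columnOperator_single, (hX i).adjoint.enorm_apply_left]

theorem sum_tsum_rpow_le_column_of_two_le (hp : 2 ≤ p)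
    (hT : IsSingularSystem (columnOperator X) e g σ)
    (hX : ∀ i, IsSingularSystem (X i) (u i) (f i) (s i)) :
    ∑ i, ∑' m, ENNReal.ofReal (s i m) ^ p ≤ ∑' k, ENNReal.ofReal (σ k) ^ p := by
  classical
  have h := hT.adjoint.tsum_enorm_apply_rpow_le
    (orthonormal_piLp_single fun i => (hX i).orthonormal_right) hp
  simpa only [ENNReal.tsum_sigma', tsum_fintype, enorm_adjoint_columnOperator_single hX] using h

theorem column_le_sum_tsum_rpow_of_le_two (hp0 : 0 < p) (hp : p ≤ 2)
    (hT : IsSingularSystem (columnOperator X) e g σ)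
    (hX : ∀ i, IsSingularSystem (X i) (u i) (f i) (s i)) :
    ∑' k, ENNReal.ofReal (σ k) ^ p ≤ ∑ i, ∑' m, ENNReal.ofReal (s i m) ^ p := by
  classical
  have hv := orthonormal_piLp_single fun i => (hX i).orthonormal_right
  have hg (k : κ) : ∑' a : Σ i, μ i, ‖⟪PiLp.single 2 a.1 (f a.1 a.2), g k⟫_ℂ‖ₑ ^ 2 = 1 := by
    obtain ⟨x, hx⟩ := hT.exists_apply_eq_right k
    calc ∑' a : Σ i, μ i, ‖⟪PiLp.single 2 a.1 (f a.1 a.2), g k⟫_ℂ‖ₑ ^ 2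
        = ∑ i, ∑' m, ‖⟪f i m, X i x⟫_ℂ‖ₑ ^ 2 := by
          simp only [ENNReal.tsum_sigma', tsum_fintype, inner_piLp_single, ← hx,
            columnOperator_apply]
      _ = ‖g k‖ₑ ^ 2 := by
          simp only [(hX _).tsum_enorm_inner_right_sq, ← hx, enorm_columnOperator_sq]
      _ = 1 := enorm_sq_eq_one (hT.orthonormal_right.1 k)
  have h := hT.adjoint.le_tsum_enorm_apply_rpow hv.1 (fun k => (hg k).ge) hp0 hp
  simpa only [ENNReal.tsum_sigma', tsum_fintype, enorm_adjoint_columnOperator_single hX] using h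

theorem ofReal_rpow_eq_sum_enorm_sq_rpow (hT : IsSingularSystem (columnOperator X) e g σ) (k : κ) :
    ENNReal.ofReal (σ k) ^ p = (∑ i, ‖X i (e k)‖ₑ ^ 2) ^ (p / 2) := by
  rw [← enorm_columnOperator_sq, sq_rpow_half, hT.enorm_apply_left]

theorem column_le_card_mul_sum_tsum_rpow_of_two_le (hp : 2 ≤ p)
    (hT : IsSingularSystem (columnOperator X) e g σ)
    (hX : ∀ i, IsSingularSystem (X i) (u i) (f i) (s i)) :
    ∑' k, ENNReal.ofReal (σ k) ^ p ≤
      (Fintype.card ι : ℝ≥0∞) ^ (p / 2 - 1) * ∑ i, ∑' m, ENNReal.ofReal (s i m) ^ p := by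
  calc ∑' k, ENNReal.ofReal (σ k) ^ p
      ≤ ∑' k, (Fintype.card ι : ℝ≥0∞) ^ (p / 2 - 1) * ∑ i, ‖X i (e k)‖ₑ ^ p := by
        refine ENNReal.tsum_le_tsum fun k => ?_
        have h := ENNReal.rpow_sum_le_const_mul_sum_rpow Finset.univ
          (fun i => ‖X i (e k)‖ₑ ^ 2) (p := p / 2) (by linarith)
        simpa only [ofReal_rpow_eq_sum_enorm_sq_rpow hT, sq_rpow_half, Finset.card_univ] using h
    _ = (Fintype.card ι : ℝ≥0∞) ^ (p / 2 - 1) * ∑ i, ∑' k, ‖X i (e k)‖ₑ ^ p := by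
        rw [ENNReal.tsum_mul_left, Summable.tsum_finsetSum fun _ _ => ENNReal.summable]
    _ ≤ (Fintype.card ι : ℝ≥0∞) ^ (p / 2 - 1) * ∑ i, ∑' m, ENNReal.ofReal (s i m) ^ p := by
        gcongr with i
        exact (hX i).tsum_enorm_apply_rpow_le hT.orthonormal_left hp

theorem sum_tsum_rpow_le_card_mul_column_of_le_two (hp0 : 0 < p) (hp : p ≤ 2)
    (hT : IsSingularSystem (columnOperator X) e g σ)
    (hX : ∀ i, IsSingularSystem (X i) (u i) (f i) (s i)) :
    ∑ i, ∑' m, ENNReal.ofReal (s i m) ^ p ≤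
      (Fintype.card ι : ℝ≥0∞) ^ (1 - p / 2) * ∑' k, ENNReal.ofReal (σ k) ^ p := by
  classical
  have hu (i : ι) (m : μ i) : ∑' k, ‖⟪e k, u i m⟫_ℂ‖ₑ ^ 2 = 1 := by
    obtain ⟨y, hy⟩ := (hX i).adjoint.exists_apply_eq_right m
    rw [← adjoint_columnOperator_single] at hy
    rw [← hy, hT.adjoint.tsum_enorm_inner_right_sq, hy,
      enorm_sq_eq_one ((hX i).orthonormal_left.1 m)]
  calc ∑ i, ∑' m, ENNReal.ofReal (s i m) ^ p
      ≤ ∑ i, ∑' k, ‖X i (e k)‖ₑ ^ p := Finset.sum_le_sum fun i _ =>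
        (hX i).le_tsum_enorm_apply_rpow hT.orthonormal_left.1 (fun m => (hu i m).ge) hp0 hp
    _ = ∑' k, ∑ i, ‖X i (e k)‖ₑ ^ p := by
        rw [Summable.tsum_finsetSum fun _ _ => ENNReal.summable]
    _ ≤ ∑' k, (Fintype.card ι : ℝ≥0∞) ^ (1 - p / 2) * ENNReal.ofReal (σ k) ^ p := by
        refine ENNReal.tsum_le_tsum fun k => ?_
        have h := sum_rpow_le_card_rpow_mul_rpow_sum Finset.univ
          (fun i => ‖X i (e k)‖ₑ ^ 2) (r := p / 2) (by linarith) (by linarith)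
        simpa only [ofReal_rpow_eq_sum_enorm_sq_rpow hT, sq_rpow_half, Finset.card_univ] using h
    _ = (Fintype.card ι : ℝ≥0∞) ^ (1 - p / 2) * ∑' k, ENNReal.ofReal (σ k) ^ p :=
        ENNReal.tsum_mul_left

end ColumnBounds

section ClarksonMcCarthyPP

variable {H : Type*} [NormedAddCommGroup H] [InnerProductSpace ℂ H] [CompleteSpace H]
  {ι ι' : Type*} [Fintype ι] [Fintype ι'] {X : ι → H →L[ℂ] H} {Y : ι' → H →L[ℂ] H} {p : ℝ}

theorem exists_isSingularSystem_columnOperator (hX : ∀ i, IsCompactOperator (X i)) :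
    ∃ (κ : Type) (e : κ → H) (g : κ → PiLp 2 (fun _ : ι => H)) (σ : κ → ℝ),
      IsSingularSystem (columnOperator X) e g σ ∧
      ∀ p, eigenvalueSum p (∑ i, adjoint (X i) ∘L X i) = ∑' k, ENNReal.ofReal (σ k) ^ p := by
  rw [← adjoint_columnOperator_comp]
  have hK : IsCompactOperator (adjoint (columnOperator X) ∘L columnOperator X) := by
    rw [adjoint_columnOperator_comp]
    exact isCompactOperator_sum fun i => (hX i).clm_comp (adjoint (X i))
  obtain ⟨e, g, h⟩ := exists_isSingularSystem (columnOperator X) hK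
  exact ⟨_, e, g, _, h, fun p => rfl⟩

theorem eigenvalueSum_bounds_of_two_le (hp : 2 ≤ p) (hX : ∀ i, IsCompactOperator (X i)) :
    ∑ i, schattenSum p (X i) ≤ eigenvalueSum p (∑ i, adjoint (X i) ∘L X i) ∧
      eigenvalueSum p (∑ i, adjoint (X i) ∘L X i) ≤
        (Fintype.card ι : ℝ≥0∞) ^ (p / 2 - 1) * ∑ i, schattenSum p (X i) := by
  obtain ⟨κ, e, g, σ, hT, hσ⟩ := exists_isSingularSystem_columnOperator hX
  choose μ u f s hs hsum using fun i => exists_isSingularSystem_schattenSum (hX i)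
  simp only [hσ, hsum]
  exact ⟨sum_tsum_rpow_le_column_of_two_le hp hT hs,
    column_le_card_mul_sum_tsum_rpow_of_two_le hp hT hs⟩

theorem eigenvalueSum_bounds_of_le_two (hp0 : 0 < p) (hp : p ≤ 2)
    (hX : ∀ i, IsCompactOperator (X i)) :
    eigenvalueSum p (∑ i, adjoint (X i) ∘L X i) ≤ ∑ i, schattenSum p (X i) ∧
      ∑ i, schattenSum p (X i) ≤
        (Fintype.card ι : ℝ≥0∞) ^ (1 - p / 2) * eigenvalueSum p (∑ i, adjoint (X i) ∘L X i) := by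
  obtain ⟨κ, e, g, σ, hT, hσ⟩ := exists_isSingularSystem_columnOperator hX
  choose μ u f s hs hsum using fun i => exists_isSingularSystem_schattenSum (hX i)
  simp only [hσ, hsum]
  exact ⟨column_le_sum_tsum_rpow_of_le_two hp0 hp hT hs,
    sum_tsum_rpow_le_card_mul_column_of_le_two hp0 hp hT hs⟩

theorem sum_schattenNorm_rpow_le_of_sum_schattenSum_le (hp : p ≠ 0) {n : ℕ} {r : ℝ} (hr : 0 ≤ r)
    (hX : ∀ i, schattenSum p (X i) ≠ ∞) (hY : ∀ j, schattenSum p (Y j) ≠ ∞)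
    (h : ∑ i, schattenSum p (X i) ≤ (n : ℝ≥0∞) ^ r * ∑ j, schattenSum p (Y j)) :
    ∑ i, schattenNorm p (X i) ^ p ≤ (n : ℝ) ^ r * ∑ j, schattenNorm p (Y j) ^ p := by
  simp only [schattenNorm_rpow hp]
  rw [← ENNReal.toReal_sum fun i _ => hX i, ← ENNReal.toReal_sum fun j _ => hY j]
  have htop : (n : ℝ≥0∞) ^ r * ∑ j, schattenSum p (Y j) ≠ ∞ :=
    ENNReal.mul_ne_top (ENNReal.rpow_ne_top_of_nonneg hr (ENNReal.natCast_ne_top n))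
      (ENNReal.sum_ne_top.2 fun j _ => hY j)
  simpa only [ENNReal.toReal_mul, ← ENNReal.toReal_rpow, ENNReal.toReal_natCast]
    using ENNReal.toReal_mono htop h

theorem sum_schattenNorm_rpow_le_of_two_le (hp : 2 ≤ p) (hX : ∀ i, MemSchatten p (X i))
    (hY : ∀ j, MemSchatten p (Y j))
    (h : ∑ i, adjoint (X i) ∘L X i = ∑ j, adjoint (Y j) ∘L Y j) :
    ∑ i, schattenNorm p (X i) ^ p ≤
      (Fintype.card ι' : ℝ) ^ (p / 2 - 1) * ∑ j, schattenNorm p (Y j) ^ p := by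
  have hXle := (eigenvalueSum_bounds_of_two_le hp fun i => (hX i).1).1
  have hYge := (eigenvalueSum_bounds_of_two_le hp fun j => (hY j).1).2
  rw [h] at hXle
  exact sum_schattenNorm_rpow_le_of_sum_schattenSum_le (by linarith) (by linarith)
    (fun i => (hX i).2) (fun j => (hY j).2) (hXle.trans hYge)

theorem sum_schattenNorm_rpow_le_of_le_two (hp0 : 0 < p) (hp : p ≤ 2)
    (hX : ∀ i, MemSchatten p (X i)) (hY : ∀ j, MemSchatten p (Y j))
    (h : ∑ i, adjoint (X i) ∘L X i = ∑ j, adjoint (Y j) ∘L Y j) :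
    ∑ i, schattenNorm p (X i) ^ p ≤
      (Fintype.card ι : ℝ) ^ (1 - p / 2) * ∑ j, schattenNorm p (Y j) ^ p := by
  have hXle := (eigenvalueSum_bounds_of_le_two hp0 hp fun i => (hX i).1).2
  have hYge := (eigenvalueSum_bounds_of_le_two hp0 hp fun j => (hY j).1).1
  rw [h] at hXle
  exact sum_schattenNorm_rpow_le_of_sum_schattenSum_le hp0.ne' (by linarith)
    (fun i => (hX i).2) (fun j => (hY j).2) (hXle.trans (mul_le_mul_right hYge _))

theorem rpow_neg_mul_le_of_le_rpow_mul {a b c r : ℝ} (hc : 0 ≤ c) (hb : 0 ≤ b)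
    (hca : c = 0 → a ≤ 0) (h : a ≤ c ^ r * b) : c ^ (-r) * a ≤ b := by
  rcases hc.eq_or_lt with hc0 | hc0
  · exact (mul_nonpos_of_nonneg_of_nonpos (Real.rpow_nonneg hc _) (hca hc0.symm)).trans hb
  · calc c ^ (-r) * a ≤ c ^ (-r) * (c ^ r * b) := by gcongr
      _ = b := by rw [← mul_assoc, ← Real.rpow_add hc0, neg_add_cancel, Real.rpow_zero, one_mul]

theorem sumSquaresEq_iff {s t : ℕ} {X : Fin s → H →L[ℂ] H} {Y : Fin t → H →L[ℂ] H} :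
    SumSquaresEq X Y ↔ ∑ i, adjoint (X i) ∘L X i = ∑ j, adjoint (Y j) ∘L Y j := by
  simp only [SumSquaresEq, CFC.abs_sq]
  rfl

theorem clarksonMcCarthyPP_of_sumSquaresEq {s t : ℕ} (hp : 0 < p)
    {X : Fin s → H →L[ℂ] H} {Y : Fin t → H →L[ℂ] H} (hX : ∀ i, MemSchatten p (X i))
    (hY : ∀ j, MemSchatten p (Y j)) (h : SumSquaresEq X Y) : ClarksonMcCarthyPP p X Y := by
  have hXY := sumSquaresEq_iff.1 h
  have hnonneg : 0 ≤ ∑ i, schattenNorm p (X i) ^ p :=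
    Finset.sum_nonneg fun i _ => Real.rpow_nonneg (schattenNorm_nonneg p (X i)) p
  refine ⟨fun hp2 => ⟨?_, ?_⟩, fun hp2 => ⟨?_, ?_⟩⟩
  · have hYX := sum_schattenNorm_rpow_le_of_two_le hp2 hY hX hXY.symm
    rw [Fintype.card_fin] at hYX
    rw [← neg_sub]
    refine rpow_neg_mul_le_of_le_rpow_mul s.cast_nonneg hnonneg (fun hs => ?_) hYX
    obtain rfl : s = 0 := Nat.cast_eq_zero.1 hs
    simpa using hYX
  · simpa only [Fintype.card_fin] using sum_schattenNorm_rpow_le_of_two_le hp2 hX hY hXY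
  · have hYX := sum_schattenNorm_rpow_le_of_le_two hp hp2 hY hX hXY.symm
    rw [Fintype.card_fin] at hYX
    rw [← neg_sub]
    refine rpow_neg_mul_le_of_le_rpow_mul t.cast_nonneg hnonneg (fun ht => ?_) hYX
    obtain rfl : t = 0 := Nat.cast_eq_zero.1 ht
    simp
  · simpa only [Fintype.card_fin] using sum_schattenNorm_rpow_le_of_le_two hp hp2 hX hY hXY

end ClarksonMcCarthyPP

/-! ### Interpolation between mixed norms -/

section Interpolation

open Complex.HadamardThreeLines Filter Topology

theorem norm_le_rpow_mul_rpow_of_norm_le_re {f : ℂ → ℂ} {g : ℝ → ℝ} (hf : Differentiable ℂ f)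
    (hg : Continuous g) (hfg : ∀ z, ‖f z‖ ≤ g z.re) {M₀ M₁ : ℝ} (h₀ : ∀ z, z.re = 0 → ‖f z‖ ≤ M₀)
    (h₁ : ∀ z, z.re = 1 → ‖f z‖ ≤ M₁) {θ : ℝ} (hθ : θ ∈ Set.Icc (0 : ℝ) 1) :
    ‖f θ‖ ≤ M₀ ^ (1 - θ) * M₁ ^ θ := by
  have hbdd : BddAbove ((norm ∘ f) '' verticalClosedStrip 0 1) := by
    obtain ⟨K, hK⟩ := (isCompact_Icc (a := (0 : ℝ)) (b := 1)).bddAbove_image hg.continuousOn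
    refine ⟨K, ?_⟩
    rintro _ ⟨z, hz, rfl⟩
    exact (hfg z).trans (hK ⟨z.re, hz, rfl⟩)
  exact norm_le_interp_of_mem_verticalClosedStrip₀₁' f (z := (θ : ℂ)) hθ hf.diffContOnCl hbdd h₀ h₁

section MixedPowSum

variable {β ι : Type*} [Fintype β] (π : β → ι) {p q : ℝ} {w : β → ℝ}

open Classical in
/-- The sum of the `q`-th powers of the weights `w` over the fibre of `π` above `i`. -/
noncomputable def fiberPowSum (q : ℝ) (w : β → ℝ) (i : ι) : ℝ :=
  ∑ b with π b = i, w b ^ q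

open Classical in
/-- The `p`-th power of the mixed norm `ℓ^p(ℓ^q)` of `w`, whose blocks are the nonempty fibres
of `π`. -/
noncomputable def mixedPowSum (p q : ℝ) (w : β → ℝ) : ℝ :=
  ∑ i ∈ Finset.univ.image π, fiberPowSum π q w i ^ (p / q)

theorem fiberPowSum_nonneg (hw : ∀ b, 0 ≤ w b) (i : ι) : 0 ≤ fiberPowSum π q w i :=
  Finset.sum_nonneg fun b _ => Real.rpow_nonneg (hw b) q

theorem fiberPowSum_pos (hw : ∀ b, 0 < w b) (b : β) : 0 < fiberPowSum π q w (π b) :=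
  Finset.sum_pos (fun b _ => Real.rpow_pos_of_pos (hw b) q) ⟨b, by simp⟩

theorem mixedPowSum_nonneg (hw : ∀ b, 0 ≤ w b) : 0 ≤ mixedPowSum π p q w :=
  Finset.sum_nonneg fun i _ => Real.rpow_nonneg (fiberPowSum_nonneg π hw i) _

theorem mixedPowSum_eq_sum_mul (hw : ∀ b, 0 < w b) :
    mixedPowSum π p q w = ∑ b, w b ^ q * fiberPowSum π q w (π b) ^ (p / q - 1) := by
  classical
  rw [← Finset.sum_fiberwise_of_maps_to (fun b _ => Finset.mem_image_of_mem π (Finset.mem_univ b)),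
    mixedPowSum]
  refine Finset.sum_congr rfl fun i hi => ?_
  obtain ⟨b, -, rfl⟩ := Finset.mem_image.1 hi
  have hfiber : ∀ c ∈ Finset.univ.filter (π · = π b),
      w c ^ q * fiberPowSum π q w (π c) ^ (p / q - 1) =
        w c ^ q * fiberPowSum π q w (π b) ^ (p / q - 1) := fun c hc => by
    rw [(Finset.mem_filter.1 hc).2]
  rw [Finset.sum_congr rfl hfiber, ← Finset.sum_mul]
  change _ = fiberPowSum π q w (π b) * _
  rw [mul_comm, ← Real.rpow_add_one (fiberPowSum_pos π hw b).ne', sub_add_cancel]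

variable {π} in
theorem mixedPowSum_of_injective (hπ : Function.Injective π) (hq : q ≠ 0) (hw : ∀ b, 0 ≤ w b) :
    mixedPowSum π p q w = ∑ b, w b ^ p := by
  classical
  rw [mixedPowSum, Finset.sum_image hπ.injOn]
  refine Finset.sum_congr rfl fun b _ => ?_
  have hfiber : fiberPowSum π q w (π b) = w b ^ q := by
    simp only [fiberPowSum, hπ.eq_iff, Finset.sum_filter]
    simp
  rw [hfiber, ← Real.rpow_mul (hw b), mul_div_cancel₀ _ hq]

/-- Stein's analytic family through `w`. It has the value `w` at `2 / q`, is bounded blockwise by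
`fiberPowSum ^ (p / q)` on the line `re z = 0`, and has constant `ℓ²` norm on `re z = 1`. -/
noncomputable def steinFamily (p q : ℝ) (w : β → ℝ) (z : ℂ) (b : β) : ℂ :=
  (fiberPowSum π q w (π b) : ℂ) ^ ((p - z * ((p + q) / 2)) / q) * (w b : ℂ) ^ (q * z / 2)

theorem differentiable_steinFamily (hw : ∀ b, 0 < w b) (b : β) :
    Differentiable ℂ fun z => steinFamily π p q w z b := by
  refine Differentiable.mul ?_ ?_
  · exact Differentiable.const_cpow (by fun_prop)
      (Or.inl (Complex.ofReal_ne_zero.2 (fiberPowSum_pos π hw b).ne'))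
  · exact Differentiable.const_cpow (by fun_prop) (Or.inl (Complex.ofReal_ne_zero.2 (hw b).ne'))

theorem norm_steinFamily (hw : ∀ b, 0 < w b) (z : ℂ) (b : β) :
    ‖steinFamily π p q w z b‖ =
      fiberPowSum π q w (π b) ^ ((p - z.re * ((p + q) / 2)) / q) * w b ^ (q * z.re / 2) := by
  rw [steinFamily, norm_mul, Complex.norm_cpow_eq_rpow_re_of_pos (fiberPowSum_pos π hw b),
    Complex.norm_cpow_eq_rpow_re_of_pos (hw b)]
  congr 2
  · have h : ((p : ℂ) - z * ((p + q) / 2)) / q = (p - z * ((p + q) / 2 : ℝ)) / q := by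
      push_cast
      rfl
    rw [h, Complex.div_ofReal_re, Complex.sub_re, Complex.re_mul_ofReal, Complex.ofReal_re]
  · have h : (q : ℂ) * z / 2 = (q : ℝ) * z / (2 : ℝ) := by push_cast; rfl
    rw [h, Complex.div_ofReal_re, Complex.re_ofReal_mul]

theorem norm_steinFamily_ofReal_re (hw : ∀ b, 0 < w b) (z : ℂ) (b : β) :
    ‖steinFamily π p q w z.re b‖ = ‖steinFamily π p q w z b‖ := by
  simp only [norm_steinFamily π hw, Complex.ofReal_re]

theorem norm_steinFamily_of_re_eq_zero (hw : ∀ b, 0 < w b) {z : ℂ} (hz : z.re = 0) (b : β) :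
    ‖steinFamily π p q w z b‖ = fiberPowSum π q w (π b) ^ (p / q) := by
  rw [norm_steinFamily π hw, hz]
  simp

theorem sum_norm_sq_steinFamily_of_re_eq_one (hq : q ≠ 0) (hw : ∀ b, 0 < w b) {z : ℂ}
    (hz : z.re = 1) : ∑ b, ‖steinFamily π p q w z b‖ ^ 2 = mixedPowSum π p q w := by
  rw [mixedPowSum_eq_sum_mul π hw]
  refine Finset.sum_congr rfl fun b _ => ?_
  rw [norm_steinFamily π hw, hz, mul_pow, mul_comm, ← Real.rpow_natCast, ← Real.rpow_natCast,
    ← Real.rpow_mul (hw b).le, ← Real.rpow_mul (fiberPowSum_pos π hw b).le]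
  congr 2 <;> push_cast <;> field_simp
  ring

theorem steinFamily_two_div (hpq : p.HolderConjugate q) (b : β) :
    steinFamily π p q w ((2 / q : ℝ) : ℂ) b = w b := by
  have hq := hpq.symm.ne_zero
  have hblock : ((p : ℂ) - (2 / q : ℝ) * ((p + q) / 2)) / q = 0 := by
    have h : (p - 2 / q * ((p + q) / 2)) / q = 0 := by
      have := hpq.mul_eq_add
      field_simp
      linarith
    exact_mod_cast h
  have hentry : (q : ℂ) * (2 / q : ℝ) / 2 = 1 := by
    have h : q * (2 / q) / 2 = 1 := by field_simp
    exact_mod_cast h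
  rw [steinFamily, hblock, hentry, Complex.cpow_zero, Complex.cpow_one, one_mul]

/-- The extremal weights pairing with `w ∈ ℓ^q(ℓ^p)` in the duality with `ℓ^p(ℓ^q)`. -/
noncomputable def dualWeight (p q : ℝ) (w : β → ℝ) (b : β) : ℝ :=
  w b ^ (p - 1) * fiberPowSum π p w (π b) ^ (q / p - 1)

theorem dualWeight_pos (hw : ∀ b, 0 < w b) (b : β) : 0 < dualWeight π p q w b :=
  mul_pos (Real.rpow_pos_of_pos (hw b) _) (Real.rpow_pos_of_pos (fiberPowSum_pos π hw b) _)

theorem sum_mul_dualWeight (hw : ∀ b, 0 < w b) :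
    ∑ b, w b * dualWeight π p q w b = mixedPowSum π q p w := by
  rw [mixedPowSum_eq_sum_mul π hw]
  refine Finset.sum_congr rfl fun b _ => ?_
  rw [dualWeight, ← mul_assoc, Real.rpow_sub_one (hw b).ne', mul_div_cancel₀ _ (hw b).ne']

theorem mixedPowSum_dualWeight (hpq : p.HolderConjugate q) (hw : ∀ b, 0 < w b) :
    mixedPowSum π p q (dualWeight π p q w) = mixedPowSum π q p w := by
  classical
  have hp := hpq.ne_zero
  have hq := hpq.symm.ne_zero
  have hmul := hpq.mul_eq_add
  refine Finset.sum_congr rfl fun i hi => ?_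
  obtain ⟨b, -, rfl⟩ := Finset.mem_image.1 hi
  set n := fiberPowSum π p w (π b) with hn
  have hn_pos : 0 < n := fiberPowSum_pos π hw b
  have hfiber : fiberPowSum π q (dualWeight π p q w) (π b) = n ^ ((q / p - 1) * q + 1) := by
    rw [Real.rpow_add_one hn_pos.ne', mul_comm, hn, fiberPowSum, fiberPowSum, Finset.sum_mul]
    refine Finset.sum_congr rfl fun c hc => ?_
    rw [dualWeight, (Finset.mem_filter.1 hc).2, Real.mul_rpow (Real.rpow_nonneg (hw c).le _)
      (Real.rpow_nonneg hn_pos.le _), ← Real.rpow_mul (hw c).le, ← Real.rpow_mul hn_pos.le,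
      ← fiberPowSum]
    congr 2
    linarith
  rw [hfiber, ← Real.rpow_mul hn_pos.le]
  congr 1
  field_simp
  linear_combination (q - p) * hmul

end MixedPowSum

variable {α β ι' ι : Type*} {π' : α → ι'} {π : β → ι} {B : β → α → ℂ} {C p q : ℝ}

open Classical in
theorem norm_bilinear_le_of_lines [Fintype α] [Fintype β] {M : ℝ} (hM : 0 ≤ M) (hp : p ≤ 2)
    (hpq : p.HolderConjugate q)
    (h₀ : ∀ (u : α → ℂ) (w : β → ℂ) (c' : ι' → ℝ) (c : ι → ℝ), (∀ a, ‖u a‖ ≤ c' (π' a)) →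
      (∀ b, ‖w b‖ ≤ c (π b)) → ‖∑ b, ∑ a, B b a * u a * w b‖ ≤
        M * (∑ i ∈ Finset.univ.image π', c' i) * ∑ i ∈ Finset.univ.image π, c i)
    (h₁ : ∀ (u : α → ℂ) (w : β → ℂ),
      ‖∑ b, ∑ a, B b a * u a * w b‖ ≤ √(∑ a, ‖u a‖ ^ 2) * √(∑ b, ‖w b‖ ^ 2))
    {u : α → ℝ} {w : β → ℝ} (hu : ∀ a, 0 < u a) (hw : ∀ b, 0 < w b) :
    ‖∑ b, ∑ a, B b a * u a * w b‖ ≤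
      M ^ (2 / p - 1) * mixedPowSum π' p q u ^ (1 / p) * mixedPowSum π p q w ^ (1 / p) := by
  set S := mixedPowSum π' p q u
  set W := mixedPowSum π p q w
  have hS : 0 ≤ S := mixedPowSum_nonneg π' fun a => (hu a).le
  have hW : 0 ≤ W := mixedPowSum_nonneg π fun b => (hw b).le
  let U := steinFamily π' p q u
  let V := steinFamily π p q w
  have hU := fun a => differentiable_steinFamily π' (p := p) (q := q) hu a
  have hV := fun b => differentiable_steinFamily π (p := p) (q := q) hw b
  have hθ : 2 / q = 2 - 2 / p := by
    have := hpq.inv_add_inv_eq_one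
    rw [div_eq_mul_inv, div_eq_mul_inv]
    linarith
  have hp_inv : 1 ≤ 2 / p := (one_le_div hpq.pos).2 hp
  have hmem : 2 / q ∈ Set.Icc (0 : ℝ) 1 := ⟨(div_pos two_pos hpq.symm.pos).le, by linarith⟩
  have hlines := norm_le_rpow_mul_rpow_of_norm_le_re (f := fun z => ∑ b, ∑ a, B b a * U z a * V z b)
    (g := fun x => ∑ b, ∑ a, ‖B b a‖ * ‖U x a‖ * ‖V x b‖) (M₀ := M * S * W) (M₁ := √S * √W)
    (by fun_prop)
    (continuous_finsetSum _ fun b _ => continuous_finsetSum _ fun a _ =>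
      (continuous_const.mul ((hU a).continuous.comp Complex.continuous_ofReal).norm).mul
        ((hV b).continuous.comp Complex.continuous_ofReal).norm)
    (fun z => (norm_sum_le _ _).trans (Finset.sum_le_sum fun b _ => (norm_sum_le _ _).trans_eq <|
      Finset.sum_congr rfl fun a _ => by
        simp only [norm_mul, U, V, norm_steinFamily_ofReal_re π' hu,
          norm_steinFamily_ofReal_re π hw]))
    (fun z hz => h₀ _ _ _ _ (fun a => (norm_steinFamily_of_re_eq_zero π' hu hz a).le)
      fun b => (norm_steinFamily_of_re_eq_zero π hw hz b).le)
    (fun z hz => (h₁ _ _).trans_eq <| by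
      rw [sum_norm_sq_steinFamily_of_re_eq_one π' hpq.symm.ne_zero hu hz,
        sum_norm_sq_steinFamily_of_re_eq_one π hpq.symm.ne_zero hw hz]) hmem
  simp only [U, V, steinFamily_two_div _ hpq] at hlines
  refine hlines.trans_eq ?_
  rw [← Real.sqrt_mul hS, Real.sqrt_eq_rpow, ← Real.rpow_mul (mul_nonneg hS hW), mul_assoc M,
    Real.mul_rpow hM (mul_nonneg hS hW), mul_assoc,
    ← Real.rpow_add_of_nonneg (mul_nonneg hS hW) (by linarith [hmem.2]) (by linarith [hmem.1]),
    mul_assoc, ← Real.mul_rpow hS hW, hθ]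
  ring_nf

/-- All finite sections of the matrix `B` are bounded by `C` as bilinear forms on
`ℓ^p(ℓ^q) × ℓ^p(ℓ^q)`, with the blocks given by the fibres of `π'` and `π`. Only positive vectors
are tested. -/
def FiniteSectionBound (π' : α → ι') (π : β → ι) (B : β → α → ℂ) (C p q : ℝ) : Prop :=
  ∀ (F : Finset α) (G : Finset β) (u : F → ℝ) (w : G → ℝ), (∀ a, 0 < u a) → (∀ b, 0 < w b) →
    ‖∑ b : G, ∑ a : F, B b a * u a * w b‖ ≤
      C * mixedPowSum (fun a : F => π' a) p q u ^ (1 / p) *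
        mixedPowSum (fun b : G => π b) p q w ^ (1 / p)

theorem FiniteSectionBound.transpose (hB : FiniteSectionBound π' π B C p q) :
    FiniteSectionBound π π' (fun a b => B b a) C p q := fun F G u w hu hw => by
  rw [Finset.sum_comm, mul_right_comm]
  simp only [mul_right_comm (B _ _) (u _ : ℂ)]
  exact hB G F w u hw hu

theorem le_rpow_of_le_mul_rpow {D K : ℝ} (hpq : p.HolderConjugate q) (hD : 0 ≤ D) (hK : 0 ≤ K)
    (h : D ≤ K * D ^ (1 / p)) : D ≤ K ^ q := by
  rcases hD.eq_or_lt with rfl | hD_pos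
  · positivity
  have hsplit : D = D ^ (1 / q) * D ^ (1 / p) := by
    rw [← Real.rpow_add hD_pos, one_div, one_div, add_comm, hpq.inv_add_inv_eq_one, Real.rpow_one]
  have hle : D ^ (1 / q) ≤ K := by
    refine le_of_mul_le_mul_right ?_ (Real.rpow_pos_of_pos hD_pos (1 / p))
    rwa [← hsplit]
  calc D = (D ^ (1 / q)) ^ q := by
        rw [← Real.rpow_mul hD, one_div, inv_mul_cancel₀ hpq.symm.ne_zero, Real.rpow_one]
    _ ≤ K ^ q := Real.rpow_le_rpow (by positivity) hle hpq.symm.nonneg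

theorem FiniteSectionBound.mixedPowSum_le (hB : FiniteSectionBound π' π B C p q) (hC : 0 ≤ C)
    (hpq : p.HolderConjugate q) {u : α → ℝ} {x : β → ℝ} (hu : ∀ a, 0 < u a) (hx : ∀ b, 0 < x b)
    (hux : ∀ b, HasSum (fun a => B b a * u a) (x b)) {S : ℝ}
    (hS : ∀ F : Finset α, mixedPowSum (fun a : F => π' a) p q (fun a => u a) ≤ S) (G : Finset β) :
    mixedPowSum (fun b : G => π b) q p (fun b => x b) ≤ C ^ q * S ^ (q / p) := by
  set D := mixedPowSum (fun b : G => π b) q p fun b => x b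
  let w := dualWeight (fun b : G => π b) p q fun b => x b
  have hS_nonneg : 0 ≤ S :=
    (mixedPowSum_nonneg (fun a : (∅ : Finset α) => π' a) fun a => (hu a).le).trans (hS ∅)
  have hD_nonneg : 0 ≤ D := mixedPowSum_nonneg _ fun b => (hx b).le
  have hpairing : HasSum (fun a => ∑ b : G, B b a * u a * w b) (D : ℂ) := by
    have hD : (D : ℂ) = ∑ b : G, (x b : ℂ) * w b := by
      exact_mod_cast (sum_mul_dualWeight _ fun b : G => hx b).symm
    rw [hD]
    exact hasSum_sum fun b _ => (hux b).mul_right _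
  have hsections : ∀ F : Finset α, ‖∑ a ∈ F, ∑ b : G, B b a * u a * w b‖ ≤
      C * S ^ (1 / p) * D ^ (1 / p) := fun F => by
    rw [← Finset.sum_coe_sort, Finset.sum_comm]
    refine (hB F G _ w (fun a => hu a) (dualWeight_pos _ fun b => hx b)).trans ?_
    rw [mixedPowSum_dualWeight _ hpq fun b : G => hx b]
    have hF : 0 ≤ mixedPowSum (fun a : F => π' a) p q fun a => u a :=
      mixedPowSum_nonneg _ fun a => (hu a).le
    have := hpq.pos
    gcongr
    exact hS F
  have hle : D ≤ C * S ^ (1 / p) * D ^ (1 / p) := by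
    have h := le_of_tendsto (Tendsto.norm hpairing) (Eventually.of_forall hsections)
    rwa [Complex.norm_real, Real.norm_of_nonneg hD_nonneg] at h
  refine (le_rpow_of_le_mul_rpow hpq hD_nonneg (by positivity) hle).trans_eq ?_
  rw [Real.mul_rpow hC (by positivity), ← Real.rpow_mul hS_nonneg, one_div_mul_eq_div]

end Interpolation

section FiberSums

open Filter Topology

variable {β ι : Type*} {π : β → ι} {p q : ℝ}

theorem hasSum_fst_preimage {κ : ι → Type*} {M : Type*} [AddCommMonoid M] [TopologicalSpace M]
    {φ : (Σ i, κ i) → M} {i : ι} {c : M} (h : HasSum (fun k => φ ⟨i, k⟩) c) :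
    HasSum (fun a : (Sigma.fst : (Σ i, κ i) → ι) ⁻¹' {i} => φ a) c := by
  rw [← Set.range_sigmaMk]
  exact sigma_mk_injective.hasSum_range_iff.2 h

variable [Fintype ι]

theorem hasSum_of_fiberwise {M : Type*} [AddCommMonoid M] [TopologicalSpace M] [ContinuousAdd M]
    {φ : β → M} {c : ι → M} (h : ∀ i, HasSum (fun b : π ⁻¹' {i} => φ b) (c i)) :
    HasSum φ (∑ i, c i) := by
  classical
  convert hasSum_sum (s := Finset.univ) fun i _ => hasSum_subtype_iff_indicator.1 (h i) with b
  simp [Set.indicator_apply]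

theorem mixedPowSum_subtype (h : p / q ≠ 0) (w : β → ℝ) (G : Finset β) :
    mixedPowSum (fun b : G => π b) p q (fun b => w b) =
      ∑ i, (∑ b ∈ G, (π ⁻¹' {i}).indicator (fun b => w b ^ q) b) ^ (p / q) := by
  classical
  have hfiber (i : ι) : fiberPowSum (fun b : G => π b) q (fun b => w b) i =
      ∑ b ∈ G, (π ⁻¹' {i}).indicator (fun b => w b ^ q) b := by
    rw [fiberPowSum, Finset.sum_filter, ← Finset.sum_coe_sort G]
    rfl
  simp only [mixedPowSum, hfiber]
  refine Finset.sum_subset (Finset.subset_univ _) fun i _ hi => ?_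
  rw [Finset.sum_eq_zero, Real.zero_rpow h]
  rintro b hb
  refine Set.indicator_of_notMem (fun hbi => hi ?_) _
  exact Finset.mem_image.2 ⟨⟨b, hb⟩, Finset.mem_univ _, hbi⟩

theorem isLUB_mixedPowSum (h : 0 < p / q) {w : β → ℝ} (hw : ∀ b, 0 ≤ w b) {n : ι → ℝ}
    (hn : ∀ i, HasSum (fun b : π ⁻¹' {i} => w b ^ q) (n i)) :
    IsLUB (Set.range fun G : Finset β => mixedPowSum (fun b : G => π b) p q fun b => w b)
      (∑ i, n i ^ (p / q)) := by
  simp only [mixedPowSum_subtype h.ne']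
  have hnonneg (i : ι) (b : β) : 0 ≤ (π ⁻¹' {i}).indicator (fun b => w b ^ q) b :=
    Set.indicator_nonneg (fun b _ => Real.rpow_nonneg (hw b) q) b
  refine isLUB_of_tendsto_atTop (fun F G hFG => ?_) ?_
  · gcongr with i
    · exact Finset.sum_nonneg fun b _ => hnonneg i b
    · exact fun b _ _ => hnonneg i b
  · exact tendsto_finsetSum _ fun i _ =>
      (hasSum_subtype_iff_indicator.1 (hn i)).rpow_const (Or.inr h.le)

end FiberSums

/-! ### Subunitary matrices in singular coordinates -/

section Subunitary

open scoped TensorProduct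

theorem norm_sum_smul_of_orthonormal {γ K : Type*} [Fintype γ] [NormedAddCommGroup K]
    [InnerProductSpace ℂ K] {v : γ → K} (hv : Orthonormal ℂ v) (c : γ → ℂ) :
    ‖∑ k, c k • v k‖ = √(∑ k, ‖c k‖ ^ 2) := by
  rw [(hasSum_fintype _).unique (hasSum_norm_sq_of_hasSum_orthonormal hv (hasSum_fintype _)),
    Real.sqrt_sq (norm_nonneg _)]

theorem norm_sum_inner_map_le_sqrt_mul_sqrt {α β K L : Type*} [Fintype α] [Fintype β]
    [NormedAddCommGroup K] [InnerProductSpace ℂ K] [NormedAddCommGroup L] [InnerProductSpace ℂ L]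
    {E : α → K} {F : β → L} (hE : Orthonormal ℂ E) (hF : Orthonormal ℂ F) (V : K →ₗᵢ[ℂ] L)
    (u : α → ℂ) (w : β → ℂ) :
    ‖∑ b, ∑ a, ⟪F b, V (E a)⟫_ℂ * u a * w b‖ ≤ √(∑ a, ‖u a‖ ^ 2) * √(∑ b, ‖w b‖ ^ 2) := by
  have hsum : ∑ b, ∑ a, ⟪F b, V (E a)⟫_ℂ * u a * w b =
      ⟪∑ b, (starRingEnd ℂ) (w b) • F b, V (∑ a, u a • E a)⟫_ℂ := by
    simp only [map_sum, map_smul, sum_inner, inner_sum, inner_smul_left, inner_smul_right,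
      Complex.conj_conj, Finset.mul_sum]
    rw [Finset.sum_comm]
    exact Finset.sum_congr rfl fun a _ => Finset.sum_congr rfl fun b _ => by ring
  rw [hsum]
  refine (norm_inner_le_norm _ _).trans_eq ?_
  rw [V.norm_map, norm_sum_smul_of_orthonormal hE, norm_sum_smul_of_orthonormal hF, mul_comm]
  simp only [RCLike.norm_conj]

variable {H : Type*} [NormedAddCommGroup H] [InnerProductSpace ℂ H] {s t : ℕ}
  {A : Matrix (Fin s) (Fin t) ℂ}

/-- The tuple `A (v₁, …, v_t)ᵀ` of vectors, as a linear map between `ℓ²`-direct sums. -/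
noncomputable def vectorAct (A : Matrix (Fin s) (Fin t) ℂ) (H : Type*) [NormedAddCommGroup H]
    [InnerProductSpace ℂ H] :
    PiLp 2 (fun _ : Fin t => H) →ₗ[ℂ] PiLp 2 (fun _ : Fin s => H) where
  toFun v := WithLp.toLp 2 fun i => ∑ j, A i j • v j
  map_add' v w := by
    ext i
    simp [Finset.sum_add_distrib]
  map_smul' c v := by
    ext i
    simp [Finset.smul_sum, smul_comm c]

theorem vectorAct_single (A : Matrix (Fin s) (Fin t) ℂ) (j : Fin t) (x : H) (i : Fin s) :
    vectorAct A H (PiLp.single 2 j x) i = A i j • x := by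
  change ∑ k, A i k • (PiLp.single 2 j x : PiLp 2 fun _ : Fin t => H) k = _
  simp [PiLp.single_apply]

namespace IsSubunitary

theorem sum_conj_mul (hA : IsSubunitary A) (j k : Fin t) :
    ∑ i, (starRingEnd ℂ) (A i j) * A i k = if j = k then 1 else 0 := by
  have h := congrFun (congrFun hA j) k
  rwa [Matrix.mul_apply, Matrix.one_apply] at h

theorem sum_inner_sum_smul (hA : IsSubunitary A) (v w : Fin t → H) :
    ∑ i, ⟪∑ j, A i j • v j, ∑ j, A i j • w j⟫_ℂ = ∑ j, ⟪v j, w j⟫_ℂ := by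
  calc ∑ i, ⟪∑ j, A i j • v j, ∑ j, A i j • w j⟫_ℂ
      = ∑ i, ∑ j, ∑ k, ((starRingEnd ℂ) (A i j) * A i k) * ⟪v j, w k⟫_ℂ := by
        refine Finset.sum_congr rfl fun i _ => ?_
        rw [sum_inner]
        refine Finset.sum_congr rfl fun j _ => ?_
        rw [inner_sum]
        refine Finset.sum_congr rfl fun k _ => ?_
        rw [inner_smul_left, inner_smul_right, mul_assoc]
    _ = ∑ j, ∑ k, (∑ i, (starRingEnd ℂ) (A i j) * A i k) * ⟪v j, w k⟫_ℂ := by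
        rw [Finset.sum_comm]
        refine Finset.sum_congr rfl fun j _ => ?_
        rw [Finset.sum_comm]
        simp only [Finset.sum_mul]
    _ = ∑ j, ⟪v j, w j⟫_ℂ := by
        simp [hA.sum_conj_mul]

/-- The action of a subunitary matrix on tuples of vectors, as an isometry of `ℓ²`-direct sums. -/
noncomputable def toLinearIsometry (hA : IsSubunitary A) (H : Type*) [NormedAddCommGroup H]
    [InnerProductSpace ℂ H] :
    PiLp 2 (fun _ : Fin t => H) →ₗᵢ[ℂ] PiLp 2 (fun _ : Fin s => H) where
  toLinearMap := vectorAct A H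
  norm_map' v := by
    rw [norm_eq_sqrt_re_inner (𝕜 := ℂ), norm_eq_sqrt_re_inner (𝕜 := ℂ) v]
    exact congrArg (fun z => √(RCLike.re z)) (hA.sum_inner_sum_smul v v)

theorem toLinearIsometry_single (hA : IsSubunitary A) (j : Fin t) (x : H) (i : Fin s) :
    hA.toLinearIsometry H (PiLp.single 2 j x) i = A i j • x :=
  vectorAct_single A j x i

theorem sumSquaresEq_matrixAct [CompleteSpace H] (hA : IsSubunitary A) (Y : Fin t → H →L[ℂ] H) :
    SumSquaresEq (matrixAct A Y) Y := by
  rw [sumSquaresEq_iff]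
  ext x
  refine ext_inner_right ℂ fun y => ?_
  simp only [sum_apply, sum_inner, ContinuousLinearMap.comp_apply,
    ContinuousLinearMap.adjoint_inner_left]
  simp only [matrixAct, sum_apply, smul_apply]
  exact hA.sum_inner_sum_smul (fun j => Y j x) (fun j => Y j y)

theorem matrixAct_conjTranspose_matrixAct (hA : IsSubunitary A) (Y : Fin t → H →L[ℂ] H) :
    matrixAct Aᴴ (matrixAct A Y) = Y := by
  funext j
  simp only [matrixAct, Finset.smul_sum, smul_smul]
  rw [Finset.sum_comm]
  simp only [← Finset.sum_smul, Matrix.conjTranspose_apply]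
  simp [hA.sum_conj_mul j]

end IsSubunitary

theorem exists_forall_inner_eq_inner_symm (H : Type*) [NormedAddCommGroup H]
    [InnerProductSpace ℂ H] [CompleteSpace H] : ∃ J : H → H, ∀ x y, ⟪J x, J y⟫_ℂ = ⟪y, x⟫_ℂ := by
  obtain ⟨_, b, -⟩ := exists_hilbertBasis ℂ H
  refine ⟨fun x => b.repr.symm (star (b.repr x)), fun x y => ?_⟩
  rw [LinearIsometryEquiv.inner_map_map, ← b.repr.inner_map_map y x, lp.inner_eq_tsum,
    lp.inner_eq_tsum]
  exact tsum_congr fun i => by simp [mul_comm]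

variable {ι α β : Type*} [Fintype ι] [DecidableEq ι]

/-- The vectors `f a` with `a` in a common fibre of `π` form orthonormal families; this is
orthonormality of `f` placed in the summands of `⨁ᵢ H` prescribed by `π`. -/
def FiberOrthonormal (π : α → ι) (f : α → H) : Prop :=
  Orthonormal ℂ fun a => (PiLp.single 2 (π a) (f a) : PiLp 2 fun _ : ι => H)

namespace FiberOrthonormal

variable {π : α → ι} {f g : α → H}

theorem comp (hf : FiberOrthonormal π f) {φ : β → α} (hφ : Function.Injective φ) :
    FiberOrthonormal (π ∘ φ) (f ∘ φ) :=
  Orthonormal.comp hf φ hφ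

theorem norm_eq_one (hf : FiberOrthonormal π f) (a : α) : ‖f a‖ = 1 := by
  simpa using Orthonormal.norm_eq_one hf a

theorem tmul {K : Type*} [NormedAddCommGroup K] [InnerProductSpace ℂ K] {x : α → K}
    (hf : FiberOrthonormal π f) (hx : ∀ a, ‖x a‖ = 1) :
    FiberOrthonormal π fun a => f a ⊗ₜ[ℂ] x a := by
  refine ⟨fun a => by simp [hf.norm_eq_one, hx], fun a b hab => ?_⟩
  have h := Orthonormal.inner_eq_zero hf hab
  beta_reduce
  rw [inner_piLp_single, PiLp.single_apply] at h ⊢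
  split_ifs at h ⊢
  · rw [TensorProduct.inner_tmul, h, zero_mul]
  · rw [inner_zero_right]

variable [Fintype α]

theorem sum_norm_inner_sq_le (hf : FiberOrthonormal π f) (i : ι) (x : H) :
    ∑ a with π a = i, ‖⟪f a, x⟫_ℂ‖ ^ 2 ≤ ‖x‖ ^ 2 := by
  have h := Orthonormal.sum_inner_products_le (s := Finset.univ) (PiLp.single 2 i x) hf
  simp only [inner_piLp_single, PiLp.norm_single] at h
  refine (Finset.sum_le_sum_of_subset_of_nonneg (Finset.filter_subset _ _)
    fun a _ _ => sq_nonneg _).trans' (Finset.sum_le_sum fun a ha => ?_) |>.trans h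
  rw [PiLp.single_apply, if_pos (Finset.mem_filter.1 ha).2]

theorem sum_norm_inner_mul_le (hf : FiberOrthonormal π f) (hg : FiberOrthonormal π g) (i : ι)
    (x y : H) : ∑ a with π a = i, ‖⟪f a, x⟫_ℂ‖ * ‖⟪g a, y⟫_ℂ‖ ≤ ‖x‖ * ‖y‖ := by
  refine (Real.sum_mul_le_sqrt_mul_sqrt _ _ _).trans ?_
  gcongr
  · exact Real.sqrt_le_iff.2 ⟨norm_nonneg x, hf.sum_norm_inner_sq_le i x⟩
  · exact Real.sqrt_le_iff.2 ⟨norm_nonneg y, hg.sum_norm_inner_sq_le i y⟩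

end FiberOrthonormal

variable {πα : α → Fin t} {πβ : β → Fin s} {e f : α → H} {g h : β → H}

/-- The matrix of `Y ↦ A Y` in singular coordinates: `e`, `f` are the singular vectors of the tuple
`Y`, in the order of `IsSingularSystem`, and `g`, `h` those of `A Y`; the maps `πα`, `πβ` record the
members of the tuples that they belong to. -/
noncomputable def singularMatrix (A : Matrix (Fin s) (Fin t) ℂ) (πα : α → Fin t) (πβ : β → Fin s)
    (e f : α → H) (g h : β → H) (b : β) (a : α) : ℂ :=
  A (πβ b) (πα a) * ⟪h b, f a⟫_ℂ * ⟪e a, g b⟫_ℂ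

variable [Fintype α] [Fintype β]

theorem norm_sum_singularMatrix_le_sum_mul_sum {M : ℝ} (hM₀ : 0 ≤ M) (hM : ∀ i j, ‖A i j‖ ≤ M)
    (he : ∀ a, ‖e a‖ = 1) (hf : ∀ a, ‖f a‖ = 1) (hg : FiberOrthonormal πβ g)
    (hh : FiberOrthonormal πβ h) {u : α → ℂ} {w : β → ℂ} {c' : α → ℝ} {c : Fin s → ℝ}
    (hu : ∀ a, ‖u a‖ ≤ c' a) (hw : ∀ b, ‖w b‖ ≤ c (πβ b)) :
    ‖∑ b, ∑ a, singularMatrix A πα πβ e f g h b a * u a * w b‖ ≤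
      M * (∑ a, c' a) * ∑ i ∈ Finset.univ.image πβ, c i := by
  have hc' (a : α) : 0 ≤ c' a := (norm_nonneg _).trans (hu a)
  have hc {i : Fin s} (hi : i ∈ Finset.univ.image πβ) : 0 ≤ c i := by
    obtain ⟨b, -, rfl⟩ := Finset.mem_image.1 hi
    exact (norm_nonneg _).trans (hw b)
  have hfiber (a : α) (i : Fin s) :
      ∑ b with πβ b = i, ‖⟪h b, f a⟫_ℂ‖ * ‖⟪g b, e a⟫_ℂ‖ ≤ 1 := by
    simpa [he, hf] using hh.sum_norm_inner_mul_le hg i (f a) (e a)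
  calc ‖∑ b, ∑ a, singularMatrix A πα πβ e f g h b a * u a * w b‖
      ≤ ∑ a, ∑ b, M * c' a * (c (πβ b) * (‖⟪h b, f a⟫_ℂ‖ * ‖⟪g b, e a⟫_ℂ‖)) := by
        rw [Finset.sum_comm]
        refine (norm_sum_le _ _).trans (Finset.sum_le_sum fun a _ => (norm_sum_le _ _).trans
          (Finset.sum_le_sum fun b _ => ?_))
        rw [singularMatrix, norm_mul, norm_mul, norm_mul, norm_mul, norm_inner_symm (e a)]
        calc _ = (‖A (πβ b) (πα a)‖ * ‖u a‖) *
              (‖w b‖ * (‖⟪h b, f a⟫_ℂ‖ * ‖⟪g b, e a⟫_ℂ‖)) := by ring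
          _ ≤ _ := by
            gcongr
            exacts [mul_nonneg hM₀ (hc' a), hM _ _, hu a, hw b]
    _ = ∑ a, M * c' a * ∑ i ∈ Finset.univ.image πβ,
          c i * ∑ b with πβ b = i, ‖⟪h b, f a⟫_ℂ‖ * ‖⟪g b, e a⟫_ℂ‖ := by
        refine Finset.sum_congr rfl fun a _ => ?_
        rw [← Finset.mul_sum, ← Finset.sum_fiberwise_of_maps_to
          (fun b _ => Finset.mem_image_of_mem πβ (Finset.mem_univ b))]
        refine congrArg _ (Finset.sum_congr rfl fun i _ => ?_)
        rw [Finset.mul_sum]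
        exact Finset.sum_congr rfl fun b hb => by rw [(Finset.mem_filter.1 hb).2]
    _ ≤ ∑ a, M * c' a * ∑ i ∈ Finset.univ.image πβ, c i := by
        refine Finset.sum_le_sum fun a _ => mul_le_mul_of_nonneg_left
          (Finset.sum_le_sum fun i hi => ?_) (mul_nonneg hM₀ (hc' a))
        exact mul_le_of_le_one_right (hc hi) (hfiber a i)
    _ = M * (∑ a, c' a) * ∑ i ∈ Finset.univ.image πβ, c i := by
        rw [← Finset.sum_mul, ← Finset.mul_sum]

theorem norm_sum_singularMatrix_le_sqrt_mul_sqrt [CompleteSpace H] (hA : IsSubunitary A)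
    (he : ∀ a, ‖e a‖ = 1) (hf : FiberOrthonormal πα f) (hg : ∀ b, ‖g b‖ = 1)
    (hh : FiberOrthonormal πβ h) (u : α → ℂ) (w : β → ℂ) :
    ‖∑ b, ∑ a, singularMatrix A πα πβ e f g h b a * u a * w b‖ ≤
      √(∑ a, ‖u a‖ ^ 2) * √(∑ b, ‖w b‖ ^ 2) := by
  obtain ⟨J, hJ⟩ := exists_forall_inner_eq_inner_symm H
  have hJ_norm (x : H) : ‖J x‖ = ‖x‖ := by
    rw [norm_eq_sqrt_re_inner (𝕜 := ℂ), hJ, ← norm_eq_sqrt_re_inner]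
  -- `⟪h b ⊗ J (g b), f a ⊗ J (e a)⟫ = ⟪h b, f a⟫ ⟪e a, g b⟫`
  let E (a : α) :=
    (PiLp.single 2 (πα a) (f a ⊗ₜ[ℂ] J (e a)) : PiLp 2 fun _ : Fin t => H ⊗[ℂ] H)
  let F (b : β) :=
    (PiLp.single 2 (πβ b) (h b ⊗ₜ[ℂ] J (g b)) : PiLp 2 fun _ : Fin s => H ⊗[ℂ] H)
  have hE : Orthonormal ℂ E := hf.tmul fun a => (hJ_norm _).trans (he a)
  have hF : Orthonormal ℂ F := hh.tmul fun b => (hJ_norm _).trans (hg b)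
  have hentry (b : β) (a : α) :
      ⟪F b, hA.toLinearIsometry _ (E a)⟫_ℂ = singularMatrix A πα πβ e f g h b a := by
    rw [inner_piLp_single, hA.toLinearIsometry_single, inner_smul_right, TensorProduct.inner_tmul,
      hJ, singularMatrix, mul_assoc]
  simpa only [hentry] using
    norm_sum_inner_map_le_sqrt_mul_sqrt hE hF (hA.toLinearIsometry (H ⊗[ℂ] H)) u w

end Subunitary

section ClarksonMcCarthyPQ

variable {H : Type*} [NormedAddCommGroup H] [InnerProductSpace ℂ H] {s t : ℕ}
  {A : Matrix (Fin s) (Fin t) ℂ} {α β : Type*} {πα : α → Fin t} {πβ : β → Fin s} {e f : α → H}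
  {g h : β → H} {σ : α → ℝ} {x : β → ℝ} {X : Fin s → H →L[ℂ] H} {Y : Fin t → H →L[ℂ] H} {p q : ℝ}

theorem norm_le_iSup_norm (A : Matrix (Fin s) (Fin t) ℂ) (i : Fin s) (j : Fin t) :
    ‖A i j‖ ≤ ⨆ ij : Fin s × Fin t, ‖A ij.1 ij.2‖ :=
  le_ciSup (f := fun ij : Fin s × Fin t => ‖A ij.1 ij.2‖) (Set.finite_range _).bddAbove (i, j)

theorem iSup_norm_nonneg (A : Matrix (Fin s) (Fin t) ℂ) :
    0 ≤ ⨆ ij : Fin s × Fin t, ‖A ij.1 ij.2‖ :=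
  Real.iSup_nonneg fun _ => norm_nonneg _

theorem IsSubunitary.finiteSectionBound [CompleteSpace H] (hA : IsSubunitary A)
    (he : ∀ a, ‖e a‖ = 1) (hf : FiberOrthonormal πα f) (hg : FiberOrthonormal πβ g)
    (hh : FiberOrthonormal πβ h) (hp : p ≤ 2) (hpq : p.HolderConjugate q) :
    FiniteSectionBound (id : α → α) πβ (singularMatrix A πα πβ e f g h)
      ((⨆ ij : Fin s × Fin t, ‖A ij.1 ij.2‖) ^ (2 / p - 1)) p q := fun F G u w hu hw => by
  classical
  have hf' := hf.comp (φ := (Subtype.val : F → α)) Subtype.val_injective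
  have hg' := hg.comp (φ := (Subtype.val : G → β)) Subtype.val_injective
  have hh' := hh.comp (φ := (Subtype.val : G → β)) Subtype.val_injective
  refine norm_bilinear_le_of_lines (iSup_norm_nonneg A) hp hpq (fun u w c' c hu hw => ?_)
    (norm_sum_singularMatrix_le_sqrt_mul_sqrt hA (e := fun a : F => e a) (fun a => he a) hf'
      hg'.norm_eq_one hh') hu hw
  rw [Finset.sum_image (g := fun a : F => id (a : α)) Subtype.val_injective.injOn]
  convert norm_sum_singularMatrix_le_sum_mul_sum (e := fun a : F => e a) (iSup_norm_nonneg A)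
    (norm_le_iSup_norm A) (fun a => he a) hf'.norm_eq_one hg' hh' hu hw using 4
  rfl

/-- Simultaneous singular systems of the members of the tuple `Y`: `e a` and `f a` are singular
vectors of `Y (π a)` with singular value `σ a`. -/
structure IsSingularFamily (Y : Fin t → H →L[ℂ] H) (π : α → Fin t) (e f : α → H) (σ : α → ℝ) :
    Prop where
  orthonormal_left : FiberOrthonormal π e
  orthonormal_right : FiberOrthonormal π f
  pos : ∀ a, 0 < σ a
  apply_left : ∀ a, Y (π a) (e a) = (σ a : ℂ) • f a
  hasSum_apply : ∀ j z, HasSum (fun a : π ⁻¹' {j} => ((σ a : ℂ) * ⟪e a, z⟫_ℂ) • f a) (Y j z)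

namespace IsSingularFamily

theorem inner_right_apply_left (hY : IsSingularFamily Y πα e f σ) (a : α) :
    ⟪f a, Y (πα a) (e a)⟫_ℂ = σ a := by
  rw [hY.apply_left, inner_smul_right, inner_self_eq_ofReal_norm_sq,
    hY.orthonormal_right.norm_eq_one]
  simp

theorem hasSum_inner_matrixAct (hY : IsSingularFamily Y πα e f σ) (A : Matrix (Fin s) (Fin t) ℂ)
    (i : Fin s) (y z : H) :
    HasSum (fun a => A i (πα a) * ⟪y, f a⟫_ℂ * ⟪e a, z⟫_ℂ * σ a) ⟪y, matrixAct A Y i z⟫_ℂ := by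
  simp only [matrixAct, sum_apply, smul_apply, inner_sum, inner_smul_right]
  refine hasSum_of_fiberwise (π := πα) fun j => ?_
  have hj : HasSum (fun a : πα ⁻¹' {j} => ⟪y, ((σ a : ℂ) * ⟪e a, z⟫_ℂ) • f a⟫_ℂ) ⟪y, Y j z⟫_ℂ :=
    (hY.hasSum_apply j z).mapL (innerSL ℂ y)
  refine (hj.mul_left (A i j)).congr_fun fun a => ?_
  rw [inner_smul_right, a.2]
  ring

theorem hasSum_singularMatrix_mul (hX : IsSingularFamily X πβ g h x)
    (hY : IsSingularFamily Y πα e f σ) (hXY : X = matrixAct A Y) (b : β) :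
    HasSum (fun a => singularMatrix A πα πβ e f g h b a * σ a) (x b) := by
  rw [← hX.inner_right_apply_left, hXY]
  exact hY.hasSum_inner_matrixAct A (πβ b) (h b) (g b)

theorem hasSum_singularMatrix_transpose_mul (hX : IsSingularFamily X πβ g h x)
    (hY : IsSingularFamily Y πα e f σ) (hYX : Y = matrixAct Aᴴ X) (a : α) :
    HasSum (fun b => singularMatrix A πα πβ e f g h b a * x b) (σ a) := by
  have hconj := (hX.hasSum_inner_matrixAct Aᴴ (πα a) (f a) (e a)).star
  rw [← hYX, hY.inner_right_apply_left, RCLike.star_def, Complex.conj_ofReal] at hconj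
  simpa only [singularMatrix, RCLike.star_def, Matrix.conjTranspose_apply, map_mul,
    Complex.conj_conj, inner_conj_symm, Complex.conj_ofReal] using hconj

end IsSingularFamily

variable [CompleteSpace H]

theorem MemSchatten.exists_isSingularSystem {T : H →L[ℂ] H} (hp : p ≠ 0) (hT : MemSchatten p T) :
    ∃ (κ : Type) (e f : κ → H) (s : κ → ℝ), IsSingularSystem T e f s ∧
      HasSum (fun k => s k ^ p) (schattenNorm p T ^ p) := by
  obtain ⟨κ, e, f, s, hs, hsum⟩ := exists_isSingularSystem_schattenSum hT.1
  have hfin := hT.2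
  rw [hsum] at hfin
  refine ⟨κ, e, f, s, hs, ?_⟩
  rw [schattenNorm_rpow hp, hsum,
    ENNReal.tsum_toReal_eq fun k => ENNReal.ne_top_of_tsum_ne_top hfin k]
  convert ENNReal.hasSum_toReal hfin with k
  rw [← ENNReal.toReal_rpow, ENNReal.toReal_ofReal (hs.pos k).le]

theorem exists_isSingularFamily (hp : p ≠ 0) (hY : ∀ j, MemSchatten p (Y j)) :
    ∃ (α : Type) (π : α → Fin t) (e f : α → H) (σ : α → ℝ), IsSingularFamily Y π e f σ ∧
      ∀ j, HasSum (fun a : π ⁻¹' {j} => σ a ^ p) (schattenNorm p (Y j) ^ p) := by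
  choose κ e f σ hσ hsum using fun j => (hY j).exists_isSingularSystem hp
  refine ⟨Σ j, κ j, Sigma.fst, fun a => e a.1 a.2, fun a => f a.1 a.2, fun a => σ a.1 a.2,
    ⟨?_, ?_, fun a => (hσ a.1).pos a.2, fun a => (hσ a.1).apply_left a.2, fun j z => ?_⟩,
    fun j => ?_⟩
  · exact orthonormal_piLp_single fun j => (hσ j).orthonormal_left
  · exact orthonormal_piLp_single fun j => (hσ j).orthonormal_right
  · exact hasSum_fst_preimage
      (φ := fun a : Σ j, κ j => ((σ a.1 a.2 : ℂ) * ⟪e a.1 a.2, z⟫_ℂ) • f a.1 a.2)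
      ((hσ j).hasSum_apply z)
  · exact hasSum_fst_preimage (φ := fun a : Σ j, κ j => σ a.1 a.2 ^ p) (hsum j)

theorem schattenNorm_rpow_rpow_div (hp : p ≠ 0) (r : ℝ) (T : H →L[ℂ] H) :
    (schattenNorm p T ^ p) ^ (r / p) = schattenNorm p T ^ r := by
  rw [← Real.rpow_mul (schattenNorm_nonneg _ _), mul_div_cancel₀ _ hp]

theorem rpow_mul_rpow_le_of_le_rpow_mul_rpow {M N W : ℝ} (hpq : p.HolderConjugate q) (hM : 0 ≤ M)
    (hN : 0 ≤ N) (hW : 0 ≤ W) (h : N ≤ (M ^ (2 / q - 1)) ^ p * W ^ (p / q)) :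
    M ^ (q / p - 1) * N ^ (q / p) ≤ W := by
  have hp := hpq.ne_zero
  have hq := hpq.symm.ne_zero
  have hexp : (2 / q - 1) * p * (q / p) = -(q / p - 1) := by
    field_simp
    linear_combination -hpq.mul_eq_add
  calc M ^ (q / p - 1) * N ^ (q / p)
      ≤ M ^ (q / p - 1) * ((M ^ (2 / q - 1)) ^ p * W ^ (p / q)) ^ (q / p) := by
        have := hpq.pos
        have := hpq.symm.pos
        gcongr
    _ = M ^ (q / p - 1) * (M ^ (q / p - 1))⁻¹ * W := by
        rw [Real.mul_rpow (by positivity) (by positivity), ← Real.rpow_mul hM, ← Real.rpow_mul hM,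
          ← Real.rpow_mul hW, hexp, Real.rpow_neg hM, div_mul_div_cancel₀ hq, div_self hp,
          Real.rpow_one, mul_assoc]
    _ ≤ W := mul_le_of_le_one_left hW mul_inv_le_one

namespace IsSubunitary

theorem sum_schattenNorm_rpow_le (hA : IsSubunitary A) (hpq : p.HolderConjugate q) (hp : p ≤ 2)
    (hXY : SchattenRelated p A X Y) :
    ∑ i, schattenNorm p (X i) ^ q ≤ (⨆ ij : Fin s × Fin t, ‖A ij.1 ij.2‖) ^ (q / p - 1) *
      (∑ j, schattenNorm p (Y j) ^ p) ^ (q / p) := by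
  obtain ⟨β, πβ, g, h, x, hx, hxsum⟩ := exists_isSingularFamily hpq.ne_zero hXY.1
  obtain ⟨α, πα, e, f, σ, hσ, hσsum⟩ := exists_isSingularFamily hpq.ne_zero hXY.2.1
  set M := ⨆ ij : Fin s × Fin t, ‖A ij.1 ij.2‖
  have hM : 0 ≤ M := iSup_norm_nonneg A
  have hbound := hA.finiteSectionBound hσ.orthonormal_left.norm_eq_one hσ.orthonormal_right
    hx.orthonormal_left hx.orthonormal_right hp hpq
  have hYsum : ∀ F : Finset α, mixedPowSum (fun a : F => id (a : α)) p q (fun a => σ a) ≤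
      ∑ j, schattenNorm p (Y j) ^ p := fun F => by
    rw [mixedPowSum_of_injective (π := fun a : F => id (a : α)) Subtype.val_injective
      hpq.symm.ne_zero fun a => (hσ.pos a).le, Finset.sum_coe_sort F fun a => σ a ^ p]
    exact sum_le_hasSum F (fun a _ => Real.rpow_nonneg (hσ.pos a).le p)
      (hasSum_of_fiberwise (φ := fun a => σ a ^ p) hσsum)
  have hle := (isLUB_mixedPowSum (div_pos hpq.symm.pos hpq.pos) (fun b => (hx.pos b).le) hxsum).2 <|
    Set.forall_mem_range.2 <| hbound.mixedPowSum_le (Real.rpow_nonneg hM _) hpq hσ.pos hx.pos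
      (hx.hasSum_singularMatrix_mul hσ hXY.2.2) hYsum
  simp only [schattenNorm_rpow_rpow_div hpq.ne_zero] at hle
  have hexp : (2 / p - 1) * q = q / p - 1 := by
    have := hpq.ne_zero
    field_simp
    linear_combination -hpq.mul_eq_add
  rwa [← Real.rpow_mul hM, hexp] at hle

theorem le_sum_schattenNorm_rpow (hA : IsSubunitary A) (hpq : p.HolderConjugate q) (hp : 2 ≤ p)
    (hXY : SchattenRelated p A X Y) :
    (⨆ ij : Fin s × Fin t, ‖A ij.1 ij.2‖) ^ (q / p - 1) *
      (∑ j, schattenNorm p (Y j) ^ p) ^ (q / p) ≤ ∑ i, schattenNorm p (X i) ^ q := by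
  obtain ⟨β, πβ, g, h, x, hx, hxsum⟩ := exists_isSingularFamily hpq.ne_zero hXY.1
  obtain ⟨α, πα, e, f, σ, hσ, hσsum⟩ := exists_isSingularFamily hpq.ne_zero hXY.2.1
  set M := ⨆ ij : Fin s × Fin t, ‖A ij.1 ij.2‖
  set N := ∑ j, schattenNorm p (Y j) ^ p
  set W := ∑ i, schattenNorm p (X i) ^ q
  have hM : 0 ≤ M := iSup_norm_nonneg A
  have hN : 0 ≤ N := Finset.sum_nonneg fun j _ => Real.rpow_nonneg (schattenNorm_nonneg _ _) _
  have hW : 0 ≤ W := Finset.sum_nonneg fun i _ => Real.rpow_nonneg (schattenNorm_nonneg _ _) _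
  have hq : q ≤ 2 := by nlinarith [hpq.mul_eq_add, hpq.symm.pos]
  have hbound := hA.finiteSectionBound hσ.orthonormal_left.norm_eq_one hσ.orthonormal_right
    hx.orthonormal_left hx.orthonormal_right hq hpq.symm
  have hYX : Y = matrixAct Aᴴ X := by rw [hXY.2.2, hA.matrixAct_conjTranspose_matrixAct]
  have hXsum : ∀ G : Finset β, mixedPowSum (fun b : G => πβ b) q p (fun b => x b) ≤ W := fun G => by
    have := (isLUB_mixedPowSum (div_pos hpq.symm.pos hpq.pos) (fun b => (hx.pos b).le) hxsum).1
      (Set.mem_range_self G)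
    simpa only [schattenNorm_rpow_rpow_div hpq.ne_zero] using this
  have hle : N ≤ (M ^ (2 / q - 1)) ^ p * W ^ (p / q) := by
    refine hasSum_le_of_sum_le (hasSum_of_fiberwise (φ := fun a => σ a ^ p) hσsum) fun F => ?_
    have := hbound.transpose.mixedPowSum_le (Real.rpow_nonneg hM _) hpq.symm hx.pos hσ.pos
      (hx.hasSum_singularMatrix_transpose_mul hσ hYX) hXsum F
    rwa [mixedPowSum_of_injective (π := fun a : F => id (a : α)) Subtype.val_injective
      hpq.symm.ne_zero fun a => (hσ.pos a).le, Finset.sum_coe_sort F fun a => σ a ^ p] at this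
  exact rpow_mul_rpow_le_of_le_rpow_mul_rpow hpq hM hN hW hle

theorem clarksonMcCarthyPQ (hA : IsSubunitary A) (hXY : SchattenRelated p A X Y) :
    ClarksonMcCarthyPQ p A X Y :=
  ⟨fun hp1 hp2 => hA.sum_schattenNorm_rpow_le (.conjExponent hp1) hp2 hXY,
    fun hp2 => hA.le_sum_schattenNorm_rpow (.conjExponent (by linarith)) hp2 hXY⟩

end IsSubunitary

end ClarksonMcCarthyPQ

/-! ### Necessity -/

section Necessity

open Filter Topology

theorem norm_map_eq_of_isOpen {𝕜 V W : Type*} [RCLike 𝕜] [NormedAddCommGroup V]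
    [InnerProductSpace 𝕜 V] [NormedAddCommGroup W] [InnerProductSpace 𝕜 W] (L : V →ₗ[𝕜] W)
    {U : Set V} (hU : IsOpen U) (hUne : U.Nonempty) (hL : ∀ x ∈ U, ‖L x‖ = ‖x‖) (x : V) :
    ‖L x‖ = ‖x‖ := by
  obtain ⟨x₀, hx₀⟩ := hUne
  have hplus : ∀ᶠ τ in 𝓝 (0 : 𝕜), x₀ + τ • x ∈ U :=
    (by fun_prop : Continuous fun τ : 𝕜 => x₀ + τ • x).continuousAt.eventually_mem
      (hU.mem_nhds (by simpa using hx₀))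
  have hminus : ∀ᶠ τ in 𝓝 (0 : 𝕜), x₀ - τ • x ∈ U :=
    (by fun_prop : Continuous fun τ : 𝕜 => x₀ - τ • x).continuousAt.eventually_mem
      (hU.mem_nhds (by simpa using hx₀))
  obtain ⟨τ, ⟨hp, hm⟩, hτ⟩ :=
    (((hplus.and hminus).filter_mono nhdsWithin_le_nhds).and self_mem_nhdsWithin :
      ∀ᶠ τ in 𝓝[≠] (0 : 𝕜), _).exists
  have hτx : ‖L (τ • x)‖ * ‖L (τ • x)‖ = ‖τ • x‖ * ‖τ • x‖ := by
    have hdom := parallelogram_law_with_norm 𝕜 x₀ (τ • x)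
    have hcod := parallelogram_law_with_norm 𝕜 (L x₀) (L (τ • x))
    rw [← map_add, ← map_sub, hL _ hp, hL _ hm, hL _ hx₀] at hcod
    linarith
  rw [mul_self_inj (norm_nonneg _) (norm_nonneg _), map_smul, norm_smul, norm_smul] at hτx
  exact mul_left_cancel₀ (norm_ne_zero_iff.2 hτ) hτx

variable {H : Type*} [NormedAddCommGroup H] [InnerProductSpace ℂ H] {s t : ℕ}
  {A : Matrix (Fin s) (Fin t) ℂ}

theorem isSubunitary_of_norm_vectorAct [Nontrivial H] (h : ∀ v, ‖vectorAct A H v‖ = ‖v‖) :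
    IsSubunitary A := by
  obtain ⟨x, hx⟩ := exists_ne (0 : H)
  ext j k
  let L : PiLp 2 (fun _ : Fin t => H) →ₗᵢ[ℂ] PiLp 2 (fun _ : Fin s => H) := ⟨vectorAct A H, h⟩
  have hL (l : Fin t) (i : Fin s) : L (PiLp.single 2 l x) i = A i l • x := vectorAct_single A l x i
  have hjk : (Aᴴ * A) j k * ⟪x, x⟫_ℂ = (1 : Matrix (Fin t) (Fin t) ℂ) j k * ⟪x, x⟫_ℂ := by
    calc (Aᴴ * A) j k * ⟪x, x⟫_ℂ = ⟪L (PiLp.single 2 j x), L (PiLp.single 2 k x)⟫_ℂ := by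
          simp only [PiLp.inner_apply, hL, inner_smul_left, inner_smul_right, Matrix.mul_apply,
            Matrix.conjTranspose_apply, Finset.sum_mul, mul_assoc, RCLike.star_def]
          exact Finset.sum_congr rfl fun i _ => by ring
      _ = ⟪x, (PiLp.single 2 k x : PiLp 2 fun _ : Fin t => H) j⟫_ℂ := by
          rw [L.inner_map_map, inner_piLp_single]
      _ = (1 : Matrix (Fin t) (Fin t) ℂ) j k * ⟪x, x⟫_ℂ := by
          by_cases hjk : j = k <;> simp [PiLp.single_apply, Matrix.one_apply, hjk]
  exact mul_right_cancel₀ (inner_self_ne_zero.2 hx) hjk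

theorem isSubunitary_of_sum_norm_sq {v₀ : Fin t → H} (hv₀ : LinearIndependent ℂ v₀)
    (h : ∀ v : Fin t → H, LinearIndependent ℂ v →
      ∑ i, ‖∑ j, A i j • v j‖ ^ 2 = ∑ j, ‖v j‖ ^ 2) : IsSubunitary A := by
  cases subsingleton_or_nontrivial H with
  | inl _ =>
    have : IsEmpty (Fin t) := ⟨fun j => hv₀.ne_zero j (Subsingleton.elim _ _)⟩
    exact Subsingleton.elim _ _
  | inr _ =>
    refine isSubunitary_of_norm_vectorAct (norm_map_eq_of_isOpen (vectorAct A H)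
      ((isOpen_setOfPred_linearIndependent (𝕜 := ℂ) (E := H)).preimage
        (PiLp.continuous_ofLp 2 _)) ⟨WithLp.toLp 2 v₀, hv₀⟩ fun v hv => ?_)
    rw [← sq_eq_sq₀ (norm_nonneg _) (norm_nonneg _), PiLp.norm_sq_eq_of_L2,
      PiLp.norm_sq_eq_of_L2]
    exact h _ hv

section FiniteRankOperator

variable {μ : Type*} [Fintype μ]

/-- The operator of finite rank with `b m ↦ v m` that vanishes on `{b m}ᗮ`, for an orthonormal
family `b`. This embeds a direct sum of copies of `H` isometrically into the Hilbert–Schmidt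
class. -/
noncomputable def finiteRankOperator (b : μ → H) :
    PiLp 2 (fun _ : μ => H) →ₗ[ℂ] H →L[ℂ] H where
  toFun v := ∑ m, InnerProductSpace.rankOne ℂ (v m) (b m)
  map_add' v w := by simp [Finset.sum_add_distrib]
  map_smul' c v := by simp [Finset.smul_sum]

variable {b : μ → H}

theorem finiteRankOperator_apply (b : μ → H) (v : PiLp 2 (fun _ : μ => H)) (x : H) :
    finiteRankOperator b v x = ∑ m, ⟪b m, x⟫_ℂ • v m := by
  simp [finiteRankOperator, sum_apply]

theorem finiteRankOperator_apply_self (hb : Orthonormal ℂ b) (v : PiLp 2 (fun _ : μ => H))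
    (m : μ) : finiteRankOperator b v (b m) = v m := by
  classical
  simp [finiteRankOperator_apply, orthonormal_iff_ite.1 hb, ite_smul]

theorem ker_finiteRankOperator (hb : Orthonormal ℂ b) :
    LinearMap.ker (finiteRankOperator b) = ⊥ := by
  refine LinearMap.ker_eq_bot'.2 fun v hv => ?_
  ext m
  rw [← finiteRankOperator_apply_self hb, hv, zero_apply, PiLp.zero_apply]

theorem finiteRankOperator_orthonormalBasis (b : OrthonormalBasis μ ℂ H) (T : H →L[ℂ] H) :
    finiteRankOperator b (WithLp.toLp 2 fun m => T (b m)) = T := by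
  ext x
  simp only [finiteRankOperator_apply, ← map_smul, ← map_sum, b.sum_repr']

theorem matrixAct_finiteRankOperator (A : Matrix (Fin s) (Fin t) ℂ) (b : μ → H)
    (v : Fin t → PiLp 2 (fun _ : μ => H)) (i : Fin s) :
    matrixAct A (finiteRankOperator b ∘ v) i = finiteRankOperator b (∑ j, A i j • v j) := by
  simp only [matrixAct, Function.comp_apply, map_sum, map_smul]

theorem isCompactOperator_finiteRankOperator (b : μ → H) (v : PiLp 2 (fun _ : μ => H)) :
    IsCompactOperator (finiteRankOperator b v) :=
  isCompactOperator_sum fun m =>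
    (isCompactOperator_of_locallyCompactSpace_rng
      (ContinuousLinearMap.toSpanSingleton ℂ (v m))).comp_clm (innerSL ℂ (b m))

variable [CompleteSpace H]

theorem adjoint_finiteRankOperator_apply (b : μ → H) (v : PiLp 2 (fun _ : μ => H)) (y : H) :
    adjoint (finiteRankOperator b v) y = ∑ m, ⟪v m, y⟫_ℂ • b m := by
  refine ext_inner_right ℂ fun x => ?_
  simp [ContinuousLinearMap.adjoint_inner_left, finiteRankOperator_apply, inner_sum, sum_inner,
    inner_smul_left, inner_smul_right, mul_comm]

theorem memSchatten_finiteRankOperator (b : μ → H) (v : PiLp 2 (fun _ : μ => H)) (p : ℝ) :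
    MemSchatten p (finiteRankOperator b v) := by
  refine ⟨isCompactOperator_finiteRankOperator b v, ?_⟩
  obtain ⟨κ, e, f, σ, h, hsum⟩ :=
    exists_isSingularSystem_schattenSum (isCompactOperator_finiteRankOperator b v)
  have hf (k : κ) : f k ∈ Submodule.span ℂ (Set.range v) := by
    obtain ⟨x, hx⟩ := h.exists_apply_eq_right k
    rw [← hx, finiteRankOperator_apply]
    exact Submodule.sum_mem _ fun m _ =>
      Submodule.smul_mem _ _ (Submodule.subset_span (Set.mem_range_self m))
  have := FiniteDimensional.span_of_finite ℂ (Set.finite_range v)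
  have : Finite κ := (LinearIndependent.of_comp (v := fun k => (⟨f k, hf k⟩ :
    Submodule.span ℂ (Set.range v))) (Submodule.subtype _)
      h.orthonormal_right.linearIndependent).finite
  have := Fintype.ofFinite κ
  rw [hsum, tsum_fintype]
  exact ENNReal.sum_ne_top.2 fun k _ =>
    ENNReal.ofReal_rpow_of_pos (h.pos k) ▸ ENNReal.ofReal_ne_top

theorem schattenSum_two_finiteRankOperator (hb : Orthonormal ℂ b)
    (v : PiLp 2 (fun _ : μ => H)) :
    schattenSum 2 (finiteRankOperator b v) = ∑ m, ‖v m‖ₑ ^ 2 := by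
  obtain ⟨κ, e, f, σ, h, hsum⟩ :=
    exists_isSingularSystem_schattenSum (isCompactOperator_finiteRankOperator b v)
  have hσ (k : κ) : ENNReal.ofReal (σ k) ^ (2 : ℝ) = ∑' m, ‖⟪f k, v m⟫_ℂ‖ₑ ^ 2 := by
    simp only [enorm_inner_symm (f k)]
    rw [ENNReal.rpow_two, ← h.adjoint.enorm_apply_left,
      tsum_enorm_sq_of_hasSum_orthonormal hb (y := adjoint (finiteRankOperator b v) (f k))]
    rw [adjoint_finiteRankOperator_apply]
    exact hasSum_fintype _
  rw [hsum, tsum_congr hσ, ENNReal.tsum_comm, tsum_fintype]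
  refine Finset.sum_congr rfl fun m _ => ?_
  simpa only [finiteRankOperator_apply_self hb] using h.tsum_enorm_inner_right_sq (b m)

theorem schattenNorm_two_finiteRankOperator (hb : Orthonormal ℂ b)
    (v : PiLp 2 (fun _ : μ => H)) :
    schattenNorm 2 (finiteRankOperator b v) ^ (2 : ℝ) = ‖v‖ ^ 2 := by
  rw [schattenNorm_rpow two_ne_zero, schattenSum_two_finiteRankOperator hb,
    PiLp.norm_sq_eq_of_L2, ENNReal.toReal_sum fun m _ => by finiteness]
  simp only [ENNReal.toReal_pow, toReal_enorm]

end FiniteRankOperator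

theorem exists_linearIndependent_piLp (hH : ∃ Y : Fin t → H →L[ℂ] H, LinearIndependent ℂ Y) :
    ∃ (d : ℕ) (b : Fin d → H) (v : Fin t → PiLp 2 (fun _ : Fin d => H)),
      Orthonormal ℂ b ∧ LinearIndependent ℂ v := by
  by_cases hfin : FiniteDimensional ℂ H
  · obtain ⟨Y, hY⟩ := hH
    let b := stdOrthonormalBasis ℂ H
    refine ⟨_, b, fun j => WithLp.toLp 2 fun m => Y j (b m), b.orthonormal,
      LinearIndependent.of_comp (finiteRankOperator b) ?_⟩
    convert hY
    exact funext fun j => finiteRankOperator_orthonormalBasis b (Y j)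
  · rw [FiniteDimensional, ← Module.rank_lt_aleph0_iff, not_lt] at hfin
    have hvec (n : ℕ) : ∃ w : Fin n → H, LinearIndependent ℂ w :=
      exists_linearIndependent_of_le_rank (Cardinal.natCast_lt_aleph0.le.trans hfin)
    obtain ⟨u, hu⟩ := hvec 1
    obtain ⟨w, hw⟩ := hvec t
    refine ⟨1, fun _ => ((‖u 0‖⁻¹ : ℝ) : ℂ) • u 0, fun j => WithLp.toLp 2 fun _ => w j,
      ⟨fun _ => ?_, Subsingleton.pairwise⟩,
      LinearIndependent.of_comp (PiLp.projₗ 2 _ 0) hw⟩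
    simp [norm_smul, hu.ne_zero 0]

variable [CompleteSpace H]

theorem isSubunitary_of_schattenNorm_two
    (hH : ∃ Y : Fin t → H →L[ℂ] H, LinearIndependent ℂ Y)
    (h : ∀ Y : Fin t → H →L[ℂ] H, LinearIndependent ℂ Y →
      (∀ p, SchattenRelated p A (matrixAct A Y) Y) →
      ∑ i, schattenNorm 2 (matrixAct A Y i) ^ (2 : ℝ) = ∑ j, schattenNorm 2 (Y j) ^ (2 : ℝ)) :
    IsSubunitary A := by
  obtain ⟨d, b, v₀, hb, hv₀⟩ := exists_linearIndependent_piLp hH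
  refine isSubunitary_of_sum_norm_sq hv₀ fun v hv => ?_
  have hY := h (finiteRankOperator b ∘ v) (hv.map' _ (ker_finiteRankOperator hb)) fun p =>
    ⟨fun i => matrixAct_finiteRankOperator A b v i ▸ memSchatten_finiteRankOperator b _ p,
      fun j => memSchatten_finiteRankOperator b (v j) p, rfl⟩
  simpa only [matrixAct_finiteRankOperator, Function.comp_apply,
    schattenNorm_two_finiteRankOperator hb] using hY

end Necessity

section Characterization

variable {H : Type*} [NormedAddCommGroup H] [InnerProductSpace ℂ H] [CompleteSpace H] {s t : ℕ}

theorem ClarksonMcCarthyPP.sum_schattenNorm_two_eq {X : Fin s → H →L[ℂ] H} {Y : Fin t → H →L[ℂ] H}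
    (h : ClarksonMcCarthyPP 2 X Y) :
    ∑ i, schattenNorm 2 (X i) ^ (2 : ℝ) = ∑ j, schattenNorm 2 (Y j) ^ (2 : ℝ) := by
  have hPP := h.1 le_rfl
  norm_num only [Real.rpow_zero, one_mul] at hPP
  exact le_antisymm hPP.2 hPP.1

theorem ClarksonMcCarthyPQ.sum_schattenNorm_two_eq {A : Matrix (Fin s) (Fin t) ℂ}
    {X : Fin s → H →L[ℂ] H} {Y : Fin t → H →L[ℂ] H} (h : ClarksonMcCarthyPQ 2 A X Y) :
    ∑ i, schattenNorm 2 (X i) ^ (2 : ℝ) = ∑ j, schattenNorm 2 (Y j) ^ (2 : ℝ) := by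
  have hq : Real.conjExponent 2 = 2 := by norm_num [Real.conjExponent]
  have hle := h.1 one_lt_two le_rfl
  have hge := h.2 le_rfl
  rw [hq, div_self two_ne_zero, sub_self, Real.rpow_zero, one_mul, Real.rpow_one] at hle hge
  exact le_antisymm hle hge

theorem IsSubunitary.clarksonMcCarthy {A : Matrix (Fin s) (Fin t) ℂ} (hA : IsSubunitary A) {p : ℝ}
    (hp : 0 < p) {X : Fin s → H →L[ℂ] H} {Y : Fin t → H →L[ℂ] H} (h : SchattenRelated p A X Y) :
    SumSquaresEq X Y ∧ ClarksonMcCarthyPP p X Y ∧ ClarksonMcCarthyPQ p A X Y := by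
  have hsq : SumSquaresEq X Y := h.2.2 ▸ hA.sumSquaresEq_matrixAct Y
  exact ⟨hsq, clarksonMcCarthyPP_of_sumSquaresEq hp h.1 h.2.1 hsq, hA.clarksonMcCarthyPQ h⟩

end Characterization

theorem theorem1p10 {H : Type*} [NormedAddCommGroup H] [InnerProductSpace ℂ H] [CompleteSpace H]
    {s t : ℕ} (A : Matrix (Fin s) (Fin t) ℂ) :
    -- sufficiency, for arbitrary tuples related by a subunitary matrix
    (IsSubunitary A → ∀ p : ℝ, 0 < p → ∀ (X : Fin s → H →L[ℂ] H) (Y : Fin t → H →L[ℂ] H),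
      SchattenRelated p A X Y →
        SumSquaresEq X Y ∧ ClarksonMcCarthyPP p X Y ∧ ClarksonMcCarthyPQ p A X Y) ∧
    -- sufficiency of the sum of squares identity for an arbitrary pair of tuples
    (∀ p : ℝ, 0 < p → ∀ (X : Fin s → H →L[ℂ] H) (Y : Fin t → H →L[ℂ] H),
      (∀ i, MemSchatten p (X i)) → (∀ j, MemSchatten p (Y j)) → SumSquaresEq X Y →
        ClarksonMcCarthyPP p X Y) ∧
    -- the characterization, if `H` admits `t` linearly independent operators
    ((∃ Y : Fin t → H →L[ℂ] H, LinearIndependent ℂ Y) → ∀ p₀ : ℝ, 0 < p₀ →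
      List.TFAE [
        IsSubunitary A,
        ∀ (X : Fin s → H →L[ℂ] H) (Y : Fin t → H →L[ℂ] H),
          SchattenRelated p₀ A X Y → LinearIndependent ℂ Y →
            ∃ U : Matrix (Fin s) (Fin t) ℂ, IsSubunitary U ∧ X = matrixAct U Y,
        ∀ (X : Fin s → H →L[ℂ] H) (Y : Fin t → H →L[ℂ] H),
          SchattenRelated p₀ A X Y → LinearIndependent ℂ Y → SumSquaresEq X Y,
        ∀ p : ℝ, 0 < p → ∀ (X : Fin s → H →L[ℂ] H) (Y : Fin t → H →L[ℂ] H),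
          SchattenRelated p A X Y → LinearIndependent ℂ Y →
            ClarksonMcCarthyPP p X Y ∧ ClarksonMcCarthyPQ p A X Y,
        ∀ p : ℝ, 0 < p → ∀ (X : Fin s → H →L[ℂ] H) (Y : Fin t → H →L[ℂ] H),
          SchattenRelated p A X Y → LinearIndependent ℂ Y → ClarksonMcCarthyPP p X Y,
        ∀ p : ℝ, 1 < p → ∀ (X : Fin s → H →L[ℂ] H) (Y : Fin t → H →L[ℂ] H),
          SchattenRelated p A X Y → LinearIndependent ℂ Y → ClarksonMcCarthyPQ p A X Y]) := by
  refine ⟨fun hA p hp X Y h => hA.clarksonMcCarthy hp h,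
    fun p hp X Y hX hY h => clarksonMcCarthyPP_of_sumSquaresEq hp hX hY h, fun hH _ _ => ?_⟩
  tfae_have 1 → 2 := fun hA X Y h _ => ⟨A, hA, h.2.2⟩
  tfae_have 2 → 3 := fun hb X Y h hY => by
    obtain ⟨U, hU, hXU⟩ := hb X Y h hY
    rw [hXU]
    exact hU.sumSquaresEq_matrixAct Y
  tfae_have 3 → 1 := fun hc => isSubunitary_of_schattenNorm_two hH fun Y hY hYA =>
    (clarksonMcCarthyPP_of_sumSquaresEq two_pos (hYA 2).1 (hYA 2).2.1
      (hc _ Y (hYA _) hY)).sum_schattenNorm_two_eq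
  tfae_have 1 → 4 := fun hA p hp X Y h _ => (hA.clarksonMcCarthy hp h).2
  tfae_have 4 → 5 := fun hd p hp X Y h hY => (hd p hp X Y h hY).1
  tfae_have 4 → 6 := fun hd p hp X Y h hY => (hd p (zero_lt_one.trans hp) X Y h hY).2
  tfae_have 5 → 1 := fun he => isSubunitary_of_schattenNorm_two hH fun Y hY hYA =>
    (he 2 two_pos _ Y (hYA 2) hY).sum_schattenNorm_two_eq
  tfae_have 6 → 1 := fun hf => isSubunitary_of_schattenNorm_two hH fun Y hY hYA =>
    (hf 2 one_lt_two _ Y (hYA 2) hY).sum_schattenNorm_two_eq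
  tfae_finish
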